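/- **Setting.** Let $\mathcal X$ be a measurable space and let $n, B \in \mathbb{N}$ with $B \ge 1$ and $n \ge 2B$; let $\delta > 0$. Let $g : \mathcal X \to [0,1]$ be measurable and let $P$ be a probability distribution on $\mathcal X \times [0,1]$. Let $\mathcal D_n = ((X_i,Y_i))_{i\le n}$ be i.i.d. from $P$, with an independent test pair $(X,Y)\sim P$; let $U_1,\dots,U_n,V_1,\dots,V_B,U$ be i.i.d. uniform on $[0,1]$ and independent of the data and the test pair. **Randomized UMD** (uniform-mass binning with double dipping, $B$ bins, randomization parameter $\delta$). Put $S_i = (1+\delta)^{-1}(g(X_i)+\delta U_i)$, with order statistics $S_{(1)}\le\dots\le S_{(n)}$ and $S_{(0)}=0$, $S_{(n+1)}=1$; let $Y_{(1)},\dots,Y_{(n)}$ be the labels arranged in the order of the scores. Put $A_b = \lceil b(n+1)/B\rceil$ for $0 \le b \le B$. For $1\le b\le B$ let $\widehat\Pi_b = (1+\delta)^{-1}\big(\mathrm{Mean}(Y_{(A_{b-1}+1)},\dots,Y_{(A_b-1)}) + \delta V_b\big)$. The output is the randomized predictor $$h(X)=h(X,U)=\sum_{b=1}^B \mathbf 1\{S_{(A_{b-1})}\le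 (1+\delta)^{-1}(g(X)+\delta U)<S_{(A_b)}\}\,\widehat\Pi_b .$$ **Calibration.** In the following, $\mathbb E[Y\mid h(X)]$, $\mathbb{E}[Y \mid h(X)=r]$ and $\ell_p\text{-ECE}(h) = (\mathbb E|\mathbb E[Y\mid h(X)]-h(X)|^p)^{1/p}$ are taken over the test point $(X,Y,U)$ for fixed $h$, that is, for fixed $\mathcal D_n$, $U_i$, $V_b$. A randomized calibrator is $(\varepsilon,\alpha)$-marginally calibrated if for all $g$ and $P$, $\Pr(|\mathbb E[Y\mid h(X)]-h(X)|\le\varepsilon)\ge 1-\alpha$, the probability being over the calibration data, the randomization of the calibrator and the test point. It is $(\varepsilon,\alpha)$-conditionally calibrated if for all $g$ and $P$, with probability at least $1-\alpha$ over the calibration data and the randomization of the calibrator, $|\mathbb E[Y\mid h(X)=r]-r|\le\varepsilon$ for every $r\in\mathrm{Range}(h)$ (excluding values $r$ that $h(X)$ takes with probability zero, where the conditional expectation is undefined). **Theorem.** For every $\alpha\in(0,1)$, randomized UMD is $(\varepsilon_1,\alpha)$-marginally calibrated and $(\varepsilon_2,\alpha)$-conditionally calibrated, where $$\varepsilon_1=\sqrt{\frac{\log(2/\alpha)}{2(\lfloor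 n/B\rfloor-1)}}+\delta,\qquad \varepsilon_2=\sqrt{\frac{\log(2B/\alpha)}{2(\lfloor n/B\rfloor-1)}}+\delta .$$ Further, for every $g$ and $P$ as above: (a) for every $\alpha \in (0,1)$, with probability at least $1-\alpha$ over $\mathcal D_n$, $U_1,\dots,U_n$, $V_1,\dots,V_B$, one has $\ell_p\text{-ECE}(h)\le\varepsilon_2$ simultaneously for all $p\in[1,\infty)$; (b) for all $p\in[1,2]$, $\mathbb E[\ell_p\text{-ECE}(h)]\le\sqrt{B/(2n)}+\delta$, the expectation being over $\mathcal D_n$, $U_1,\dots,U_n$, $V_1,\dots,V_B$. -/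

import Mathlib

open MeasureTheory ProbabilityTheory Set
open scoped unitInterval

noncomputable section

namespace RandomizedUMD

/-! ### Calibration of predictors

The feature space is `𝒳`, labels and scores live in `I = [0, 1]`, and `P` is the joint law of
`(X, Y)` on `𝒳 × I`. A randomized predictor is a function `h : 𝒳 × I → ℝ`: its prediction for `X` is
`h (X, U)`, where `U` is uniform on `[0, 1]` and independent of `(X, Y)`. -/

section Calibration

variable {𝒳 : Type*} [MeasurableSpace 𝒳]

/-- The law of an independent test triple `((X, Y), U)`: `(X, Y) ∼ P` and `U ∼ Unif[0, 1]`. -/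
def testLaw (P : Measure (𝒳 × I)) : Measure ((𝒳 × I) × I) :=
  P.prod (volume : Measure I)

instance (P : Measure (𝒳 × I)) [IsProbabilityMeasure P] : IsProbabilityMeasure (testLaw P) := by
  unfold testLaw; infer_instance

/-- The label `Y` of a test triple. -/
def label (ω : (𝒳 × I) × I) : I := ω.1.2

/-- The prediction `h (X, U)` on a test triple. -/
def prediction (h : 𝒳 × I → ℝ) (ω : (𝒳 × I) × I) : ℝ := h (ω.1.1, ω.2)

/-- The regression function `r ↦ E[Y ∣ h(X) = r]`, for a fixed predictor `h`. -/
def condMean (P : Measure (𝒳 × I)) [IsProbabilityMeasure P] (h : 𝒳 × I → ℝ) (r : ℝ) : ℝ :=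
  ∫ y, (y : ℝ) ∂(condDistrib label (prediction h) (testLaw P) r)

/-- The property `∀ r ∈ Range(h), |E[Y ∣ h(X) = r] - r| ≤ ε`. As `E[Y ∣ h(X) = r]` is determined
only up to null sets of the law of `h(X)`, "every `r`" means almost every `r` for that law; if `h`
has countable range this is every `r` in the range with `Pr(h(X) = r) > 0`
(see `uniformlyCalibrated_iff`). -/
def UniformlyCalibrated (P : Measure (𝒳 × I)) [IsProbabilityMeasure P] (h : 𝒳 × I → ℝ)
    (ε : ℝ) : Prop :=
  ∀ᵐ r ∂((testLaw P).map (prediction h)), |condMean P h r - r| ≤ ε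

theorem uniformlyCalibrated_iff (P : Measure (𝒳 × I)) [IsProbabilityMeasure P]
    (h : 𝒳 × I → ℝ) (hm : Measurable h) (hc : (range h).Countable) (ε : ℝ) :
    UniformlyCalibrated P h ε ↔
      ∀ r ∈ range h, testLaw P {ω | prediction h ω = r} ≠ 0 → |condMean P h r - r| ≤ ε := by
  have hp : Measurable (prediction h) := by unfold prediction; fun_prop
  have key : ∀ r, (testLaw P).map (prediction h) {r} = testLaw P {ω | prediction h ω = r} :=
    fun r => Measure.map_apply hp (measurableSet_singleton r)
  unfold UniformlyCalibrated
  constructor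
  · intro H r _ h0
    by_contra hr
    apply h0
    rw [← key]
    exact measure_mono_null (by simpa using hr) (ae_iff.1 H)
  · intro H
    have h1 : ∀ᵐ r ∂((testLaw P).map (prediction h)), r ∈ range h := by
      exact (ae_map_iff hp.aemeasurable hc.measurableSet).2 (ae_of_all _ fun ω => mem_range_self _)
    have h2 : ∀ᵐ r ∂((testLaw P).map (prediction h)), ∀ s ∈ range h,
        testLaw P {ω | prediction h ω = s} = 0 → r ≠ s := by
      rw [ae_ball_iff hc]
      intro s _
      by_cases h0 : testLaw P {ω | prediction h ω = s} = 0
      · rw [← key] at h0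
        filter_upwards [compl_mem_ae_iff.2 h0] with r hr _
        exact hr
      · simp [h0]
    filter_upwards [h1, h2] with r hr hs
    exact H r hr fun h0 => hs r hr h0 rfl

/-- The `ℓ_p`-expected calibration error of a fixed predictor `h`,
`(E |E[Y ∣ h(X)] - h(X)|^p)^(1/p)`. -/
def ece (P : Measure (𝒳 × I)) [IsProbabilityMeasure P] (h : 𝒳 × I → ℝ) (p : ℝ) : ℝ :=
  (∫ ω, |condMean P h (prediction h ω) - prediction h ω| ^ p ∂(testLaw P)) ^ (1 / p)

/-! ### Calibrators

A randomized calibrator `H` maps a predictor `g : 𝒳 → I`, calibration data `D`, and a seed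
`θ ∼ ν` that is independent of everything else, to a randomized predictor `H g D θ`. -/

variable {n : ℕ} {Θ : Type*} [MeasurableSpace Θ]

/-- The law of the calibration data (`n` independent draws from `P`) and of the seed. -/
def trainLaw (n : ℕ) (P : Measure (𝒳 × I)) (ν : Measure Θ) :
    Measure ((Fin n → 𝒳 × I) × Θ) :=
  (Measure.pi fun _ => P).prod ν

/-- `(ε, α)`-marginal calibration: for all `g` and `P`, the inequality
`|E[Y ∣ h(X)] - h(X)| ≤ ε` fails with probability at most `α`, over the calibration data, the seed
and the test point. -/
def MarginallyCalibrated (ν : Measure Θ)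
    (H : (𝒳 → I) → (Fin n → 𝒳 × I) → Θ → 𝒳 × I → ℝ) (ε α : ℝ) : Prop :=
  ∀ g : 𝒳 → I, Measurable g → ∀ (P : Measure (𝒳 × I)) [IsProbabilityMeasure P],
    ((trainLaw n P ν).prod (testLaw P))
      {τ | |condMean P (H g τ.1.1 τ.1.2) (prediction (H g τ.1.1 τ.1.2) τ.2)
          - prediction (H g τ.1.1 τ.1.2) τ.2| ≤ ε}ᶜ ≤ ENNReal.ofReal α

/-- `(ε, α)`-conditional calibration: for all `g` and `P`, the property
`∀ r ∈ Range(h), |E[Y ∣ h(X) = r] - r| ≤ ε` fails with probability at most `α`, over the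
calibration data and the seed. -/
def ConditionallyCalibrated (ν : Measure Θ)
    (H : (𝒳 → I) → (Fin n → 𝒳 × I) → Θ → 𝒳 × I → ℝ) (ε α : ℝ) : Prop :=
  ∀ g : 𝒳 → I, Measurable g → ∀ (P : Measure (𝒳 × I)) [IsProbabilityMeasure P],
    trainLaw n P ν {τ | UniformlyCalibrated P (H g τ.1 τ.2) ε}ᶜ ≤ ENNReal.ofReal α

end Calibration

/-! ### The algorithm -/

section Algorithm

variable {𝒳 : Type*} {n : ℕ}

/-- The order statistics `S_(1) ≤ … ≤ S_(n)`, with `S_(0) = 0` and `S_(n+1) = 1`. -/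
def orderStat (S : Fin n → ℝ) (k : ℕ) : ℝ :=
  if k = 0 then 0 else if hk : k - 1 < n then S (Tuple.sort S ⟨k - 1, hk⟩) else 1

/-- `Y_(1), …, Y_(n)`: the labels arranged in the order of the scores `S`
(only indices in `1, …, n` are ever used). -/
def orderedLabel (S Y : Fin n → ℝ) (k : ℕ) : ℝ :=
  if hk : k - 1 < n then Y (Tuple.sort S ⟨k - 1, hk⟩) else 0

/-- The boundary index `A_b = ⌈b Δ⌉`, with `Δ = (n + 1) / B`. -/
def boundary (n B b : ℕ) : ℕ := ⌈(b : ℝ) * (((n : ℝ) + 1) / (B : ℝ))⌉₊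

/-- The mean of `Y_(l+1), …, Y_(u-1)`, for `l = A_b` and `u = A_(b+1)`
(bins are numbered from `0`). -/
def binMean (B : ℕ) (S Y : Fin n → ℝ) (b : ℕ) : ℝ :=
  (∑ k ∈ Finset.Ioo (boundary n B b) (boundary n B (b + 1)), orderedLabel S Y k) /
    ((Finset.Ioo (boundary n B b) (boundary n B (b + 1))).card : ℝ)

/-- The perturbation `(1 + δ)⁻¹ (t + δ u)`. -/
def perturb (δ t u : ℝ) : ℝ := (1 + δ)⁻¹ * (t + δ * u)

/-- The seed of the algorithm: `U_1, …, U_n` and `V_1, …, V_B`. -/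
abbrev Seed (n B : ℕ) : Type := (Fin n → I) × (Fin B → I)

/-- All seed variables are independent and uniform on `[0, 1]`. -/
def seedLaw (n B : ℕ) : Measure (Seed n B) :=
  (Measure.pi fun _ => (volume : Measure I)).prod (Measure.pi fun _ => (volume : Measure I))

/-- The perturbed scores `S_i = (1 + δ)⁻¹ (g(X_i) + δ U_i)`. -/
def scores (δ : ℝ) (g : 𝒳 → I) (D : Fin n → 𝒳 × I) (U : Fin n → I) (i : Fin n) : ℝ :=
  perturb δ (g (D i).1) (U i)

open Classical in
/-- Randomized UMD (uniform-mass binning with double dipping), with `B` bins and randomization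
parameter `δ`: the output at the feature `z.1`, with test-time noise `z.2`. -/
def umd (B : ℕ) (δ : ℝ) (g : 𝒳 → I) (D : Fin n → 𝒳 × I) (θ : Seed n B) (z : 𝒳 × I) : ℝ :=
  ∑ b : Fin B,
    if orderStat (scores δ g D θ.1) (boundary n B b) ≤ perturb δ (g z.1) z.2 ∧
        perturb δ (g z.1) z.2 < orderStat (scores δ g D θ.1) (boundary n B (b + 1))
    then perturb δ (binMean B (scores δ g D θ.1) (fun i => ((D i).2 : ℝ)) b) (θ.2 b)
    else 0

end Algorithm

end RandomizedUMD

end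

/-!
The proof rests on three observations. First, for `δ > 0` the randomized scores have no atoms, so
almost surely there are no ties; the values `Π̂_b` are also almost surely distinct, and then
conditioning on `h(X) = r` is conditioning on a single bin.

Second, double dipping is harmless: given the two order statistics that bound a bin and the set of
indices strictly between them, the points with these indices are i.i.d. from the law of a test point
conditioned on the bin. Their mean label therefore obeys Hoeffding's inequality and the variance
bound `1 / (4 N)`, conditionally on everything which determines the bin, where
`N ≥ ⌊n / B⌋ - 1` is their number.

Third, the `n + 1` scores of the calibration points and the test point are exchangeable, so the
expected mass of a bin is exactly `(A_{b+1} - A_b) / (n + 1) = (N + 1) / (n + 1)`. Summing the tail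
bounds weighted by these masses gives the marginal guarantee without a union bound, and summing
the variances with the same weights bounds the expected squared error by `B / (2 n)`, whence the
bound on the ECE by Minkowski's and Jensen's inequalities.
-/

noncomputable section

namespace RandomizedUMD

section OrderStatistics

variable {n : ℕ}

theorem card_filter_comp_sort (s : Fin n → ℝ) (p : ℝ → Prop) [DecidablePred p] :
    (Finset.univ.filter fun i => p (s (Tuple.sort s i))).card =
      (Finset.univ.filter fun i => p (s i)).card :=
  Finset.card_equiv (Tuple.sort s) (by simp)

theorem orderStat_zero (s : Fin n → ℝ) : orderStat s 0 = 0 := by simp [orderStat]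

theorem orderStat_succ (s : Fin n → ℝ) (j : Fin n) :
    orderStat s (j + 1) = s (Tuple.sort s j) := by
  simp [orderStat]

theorem orderStat_of_lt (s : Fin n → ℝ) {k : ℕ} (hk : n < k) : orderStat s k = 1 := by
  unfold orderStat
  rw [if_neg (by omega), dif_neg (by omega)]

@[elab_as_elim]
theorem orderStat_index_cases {motive : ℕ → Prop} (zero : motive 0)
    (succ : ∀ j : Fin n, motive (j + 1)) (of_lt : ∀ k, n < k → motive k) (k : ℕ) : motive k := by
  rcases k with _ | j
  · exact zero
  · by_cases hj : j < n
    · exact succ ⟨j, hj⟩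
    · exact of_lt _ (by omega)

theorem orderStat_succ_le_iff (s : Fin n → ℝ) (j : Fin n) {x : ℝ} :
    orderStat s (j + 1) ≤ x ↔ j < (Finset.univ.filter fun i => s i ≤ x).card := by
  rw [orderStat_succ, ← card_filter_comp_sort s (· ≤ x)]
  exact (Tuple.lt_card_le_iff_apply_le_of_monotone (Tuple.monotone_sort s)).symm

theorem orderStat_succ_lt_iff (s : Fin n → ℝ) (j : Fin n) {x : ℝ} :
    orderStat s (j + 1) < x ↔ j < (Finset.univ.filter fun i => s i < x).card := by
  rw [orderStat_succ, ← card_filter_comp_sort s (· < x)]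
  exact (Tuple.lt_card_lt_iff_apply_lt_of_monotone (Tuple.monotone_sort s)).symm

theorem orderStat_le_iff (s : Fin n → ℝ) (k : ℕ) {x : ℝ} (hx : x ∈ Ico (0 : ℝ) 1) :
    orderStat s k ≤ x ↔ k ≤ (Finset.univ.filter fun i => s i ≤ x).card := by
  induction k using orderStat_index_cases (n := n) with
  | zero => simp [orderStat_zero, hx.1]
  | succ j => rw [orderStat_succ_le_iff, Nat.succ_le_iff]
  | of_lt k hk =>
    have hcard : (Finset.univ.filter fun i => s i ≤ x).card ≤ n := card_finset_fin_le _
    rw [orderStat_of_lt s hk]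
    exact iff_of_false hx.2.not_ge (by omega)

theorem orderStat_mem_Icc {s : Fin n → ℝ} (h : ∀ i, s i ∈ Icc (0 : ℝ) 1) (k : ℕ) :
    orderStat s k ∈ Icc (0 : ℝ) 1 := by
  induction k using orderStat_index_cases (n := n) with
  | zero => simp [orderStat_zero]
  | succ j => rw [orderStat_succ]; exact h _
  | of_lt k hk => simp [orderStat_of_lt s hk]

theorem monotone_orderStat {s : Fin n → ℝ} (h : ∀ i, s i ∈ Icc (0 : ℝ) 1) :
    Monotone (orderStat s) := by
  intro k m hkm
  rcases (orderStat_mem_Icc h m).2.eq_or_lt with h1 | h1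
  · exact (orderStat_mem_Icc h k).2.trans_eq h1.symm
  · have hm : orderStat s m ∈ Ico (0 : ℝ) 1 := ⟨(orderStat_mem_Icc h m).1, h1⟩
    exact (orderStat_le_iff s k hm).2 (hkm.trans ((orderStat_le_iff s m hm).1 le_rfl))

theorem measurable_orderStat (k : ℕ) : Measurable fun s : Fin n → ℝ => orderStat s k := by
  induction k using orderStat_index_cases (n := n) with
  | zero => simp only [orderStat_zero, measurable_const]
  | succ j =>
    refine measurable_of_Iic fun x => ?_
    simp only [preimage, mem_Iic, orderStat_succ_le_iff, Finset.card_filter]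
    refine measurableSet_lt measurable_const (Finset.measurable_sum _ fun i _ => ?_)
    exact Measurable.ite (measurableSet_le (measurable_pi_apply i) measurable_const)
      measurable_const measurable_const
  | of_lt k hk => simp only [orderStat_of_lt _ hk, measurable_const]

/-- Scores in general position: no ties, and no score at an end of the unit interval. -/
def NoTies (s : Fin n → ℝ) : Prop := Function.Injective s ∧ ∀ i, s i ∈ Ioo (0 : ℝ) 1

theorem NoTies.orderStat_pos {s : Fin n → ℝ} (h : NoTies s) {k : ℕ} (hk : 0 < k) :
    0 < orderStat s k := by
  induction k using orderStat_index_cases (n := n) with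
  | zero => exact absurd hk (lt_irrefl 0)
  | succ j => rw [orderStat_succ]; exact (h.2 _).1
  | of_lt k hkn => rw [orderStat_of_lt s hkn]; exact one_pos

theorem NoTies.orderStat_lt_one {s : Fin n → ℝ} (h : NoTies s) {k : ℕ} (hk : k ≤ n) :
    orderStat s k < 1 := by
  induction k using orderStat_index_cases (n := n) with
  | zero => rw [orderStat_zero]; exact one_pos
  | succ j => rw [orderStat_succ]; exact (h.2 _).2
  | of_lt k hkn => exact absurd hk hkn.not_ge

theorem NoTies.strictMonoOn_orderStat {s : Fin n → ℝ} (h : NoTies s) :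
    StrictMonoOn (orderStat s) (Iic (n + 1)) := by
  intro k _ m hm hkm
  have hm : m ≤ n + 1 := hm
  induction k using orderStat_index_cases (n := n) with
  | zero => rw [orderStat_zero]; exact h.orderStat_pos hkm
  | of_lt k hk => omega
  | succ i =>
    induction m using orderStat_index_cases (n := n) with
    | zero => omega
    | of_lt m hmn => rw [orderStat_of_lt s hmn]; exact h.orderStat_lt_one i.2
    | succ j =>
      have hsort : StrictMono (s ∘ Tuple.sort s) :=
        (Tuple.monotone_sort s).strictMono_of_injective (h.1.comp (Tuple.sort s).injective)
      rw [orderStat_succ, orderStat_succ]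
      exact hsort (Fin.lt_def.2 (by omega))

theorem orderStat_le_congr {s s' : Fin n → ℝ} {x : ℝ} (h : ∀ i, s i ≤ x ↔ s' i ≤ x) (k : ℕ) :
    orderStat s k ≤ x ↔ orderStat s' k ≤ x := by
  induction k using orderStat_index_cases (n := n) with
  | zero => simp only [orderStat_zero]
  | succ j => simp only [orderStat_succ_le_iff, h]
  | of_lt k hk => simp only [orderStat_of_lt _ hk]

theorem orderStat_lt_congr {s s' : Fin n → ℝ} {x : ℝ} (h : ∀ i, s i < x ↔ s' i < x) (k : ℕ) :
    orderStat s k < x ↔ orderStat s' k < x := by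
  induction k using orderStat_index_cases (n := n) with
  | zero => simp only [orderStat_zero]
  | succ j => simp only [orderStat_succ_lt_iff, h]
  | of_lt k hk => simp only [orderStat_of_lt _ hk]

theorem orderStat_eq_of_forall_le_iff {s s' : Fin n → ℝ} {k : ℕ}
    (h : ∀ i, s i ≤ min (orderStat s k) (orderStat s' k) ↔
      s' i ≤ min (orderStat s k) (orderStat s' k)) :
    orderStat s k = orderStat s' k := by
  have hk := orderStat_le_congr h k
  simp only [le_min_iff, le_refl, true_and, and_true] at hk
  exact (le_total _ _).elim (fun hle => hle.antisymm (hk.1 hle)) fun hle => (hk.2 hle).antisymm hle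

theorem orderStat_eq_of_forall_lt_iff {s s' : Fin n → ℝ} {k : ℕ}
    (h : ∀ i, s i < max (orderStat s k) (orderStat s' k) ↔
      s' i < max (orderStat s k) (orderStat s' k)) :
    orderStat s k = orderStat s' k := by
  have hk := orderStat_lt_congr h k
  simp only [lt_max_iff, lt_irrefl, false_or, or_false] at hk
  exact le_antisymm (le_of_not_gt fun hlt => hlt.not_gt (hk.2 hlt))
    (le_of_not_gt fun hlt => hlt.not_gt (hk.1 hlt))

/-- The pair of order statistics that bounds the `l`-to-`u` block of the scores. -/
def blockEnds (l u : ℕ) (s : Fin n → ℝ) : ℝ × ℝ := (orderStat s l, orderStat s u)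

theorem measurable_blockEnds (l u : ℕ) : Measurable (blockEnds (n := n) l u) :=
  (measurable_orderStat l).prodMk (measurable_orderStat u)

/-- The indices of the scores strictly between two order statistics. -/
def innerIndices (l u : ℕ) (s : Fin n → ℝ) : Finset (Fin n) :=
  Finset.univ.filter fun i => (blockEnds l u s).1 < s i ∧ s i < (blockEnds l u s).2

theorem mem_innerIndices {l u : ℕ} {s : Fin n → ℝ} {i : Fin n} :
    i ∈ innerIndices l u s ↔ s i ∈ Ioo (blockEnds l u s).1 (blockEnds l u s).2 := by
  simp [innerIndices]

theorem measurableSet_mem_innerIndices (l u : ℕ) (i : Fin n) :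
    MeasurableSet {s : Fin n → ℝ | i ∈ innerIndices l u s} := by
  simp only [mem_innerIndices]
  exact (measurableSet_lt (measurable_blockEnds l u).fst (measurable_pi_apply i)).inter
    (measurableSet_lt (measurable_pi_apply i) (measurable_blockEnds l u).snd)

theorem measurableSet_innerIndices_eq (l u : ℕ) (M : Finset (Fin n)) :
    MeasurableSet {s : Fin n → ℝ | innerIndices l u s = M} := by
  simp only [Finset.ext_iff, ofPred_forall]
  exact MeasurableSet.iInter fun i =>
    (measurableSet_mem_innerIndices l u i).iff (MeasurableSet.const _)

theorem blockEnds_eq_of_eqOn_compl {l u : ℕ} {s s' : Fin n → ℝ} {M : Finset (Fin n)}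
    (hs : ∀ i ∉ M, s i = s' i)
    (hM : ∀ i ∈ M, s i ∈ Ioo (blockEnds l u s ⊓ blockEnds l u s').1
      (blockEnds l u s ⊔ blockEnds l u s').2)
    (hM' : ∀ i ∈ M, s' i ∈ Ioo (blockEnds l u s ⊓ blockEnds l u s').1
      (blockEnds l u s ⊔ blockEnds l u s').2) :
    blockEnds l u s = blockEnds l u s' := by
  refine Prod.ext (orderStat_eq_of_forall_le_iff fun i => ?_)
    (orderStat_eq_of_forall_lt_iff fun i => ?_)
  all_goals by_cases hi : i ∈ M
  · exact iff_of_false (hM i hi).1.not_ge (hM' i hi).1.not_ge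
  · rw [hs i hi]
  · exact iff_of_true (hM i hi).2 (hM' i hi).2
  · rw [hs i hi]

theorem blockEnds_eq_of_innerIndices_eq {l u : ℕ} {s s' : Fin n → ℝ}
    (hs : ∀ i ∉ innerIndices l u s, s i = s' i) (h : innerIndices l u s' = innerIndices l u s) :
    blockEnds l u s' = blockEnds l u s :=
  (blockEnds_eq_of_eqOn_compl hs
    (fun _ hi => Ioo_subset_Ioo inf_le_left le_sup_left (mem_innerIndices.1 hi))
    fun _ hi => Ioo_subset_Ioo inf_le_right le_sup_right (mem_innerIndices.1 (h ▸ hi))).symm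

theorem innerIndices_eq_iff_of_eqOn_compl {l u : ℕ} {s s' : Fin n → ℝ}
    (hs : ∀ i ∉ innerIndices l u s, s i = s' i) :
    innerIndices l u s' = innerIndices l u s ↔
      ∀ i ∈ innerIndices l u s, s' i ∈ Ioo (blockEnds l u s).1 (blockEnds l u s).2 := by
  refine ⟨fun h i hi => ?_, fun h => ?_⟩
  · rw [← blockEnds_eq_of_innerIndices_eq hs h]
    exact mem_innerIndices.1 (h ▸ hi)
  · have hends : blockEnds l u s = blockEnds l u s' := blockEnds_eq_of_eqOn_compl hs
      (fun _ hi => Ioo_subset_Ioo inf_le_left le_sup_left (mem_innerIndices.1 hi))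
      fun i hi => Ioo_subset_Ioo inf_le_left le_sup_left (h i hi)
    ext i
    rw [mem_innerIndices, ← hends]
    by_cases hi : i ∈ innerIndices l u s
    · exact iff_of_true (h i hi) hi
    · rw [← hs i hi, ← mem_innerIndices]

theorem NoTies.sort_mem_innerIndices {s : Fin n → ℝ} (h : NoTies s) {l u : ℕ} (hl : l ≤ n)
    (hu : u ≤ n + 1) (j : Fin n) :
    Tuple.sort s j ∈ innerIndices l u s ↔ (j : ℕ) + 1 ∈ Finset.Ioo l u := by
  rw [mem_innerIndices, mem_Ioo, Finset.mem_Ioo, blockEnds, ← orderStat_succ s j,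
    h.strictMonoOn_orderStat.lt_iff_lt (by simp; omega) (by simp),
    h.strictMonoOn_orderStat.lt_iff_lt (by simp) (by simpa using hu)]

theorem NoTies.sum_orderedLabel {s : Fin n → ℝ} (h : NoTies s) {l u : ℕ} (hl : l ≤ n)
    (hu : u ≤ n + 1) (y : Fin n → ℝ) :
    ∑ k ∈ Finset.Ioo l u, orderedLabel s y k = ∑ i ∈ innerIndices l u s, y i := by
  symm
  refine Finset.sum_bij (fun i _ => ((Tuple.sort s).symm i : ℕ) + 1) ?_ ?_ ?_ ?_
  · intro i hi
    rw [← h.sort_mem_innerIndices hl hu, Equiv.apply_symm_apply]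
    exact hi
  · intro i _ j _ hij
    exact (Tuple.sort s).symm.injective (Fin.ext (by omega))
  · intro k hk
    have hk' := Finset.mem_Ioo.1 hk
    refine ⟨Tuple.sort s ⟨k - 1, by omega⟩, ?_, by simp; omega⟩
    rw [h.sort_mem_innerIndices hl hu]
    simpa [Nat.sub_add_cancel (show 1 ≤ k by omega)] using hk'
  · intro i _
    simp [orderedLabel]

theorem NoTies.card_innerIndices {s : Fin n → ℝ} (h : NoTies s) {l u : ℕ} (hl : l ≤ n)
    (hu : u ≤ n + 1) : (innerIndices l u s).card = (Finset.Ioo l u).card := by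
  have hsum := h.sum_orderedLabel hl hu fun _ => 1
  have hone : ∀ k ∈ Finset.Ioo l u, orderedLabel s (fun _ => 1) k = 1 := by
    intro k hk
    rw [orderedLabel, dif_pos (by rw [Finset.mem_Ioo] at hk; omega)]
  rw [Finset.sum_congr rfl hone, Finset.sum_const, Finset.sum_const, nsmul_one, nsmul_one] at hsum
  exact_mod_cast hsum.symm

end OrderStatistics

section ContinuousScores

variable {Z : Type*} [MeasurableSpace Z] {μ : Measure Z}

/-- Scores in the unit interval without atoms: this is what the randomization of the scores
achieves, so that independent scores have no ties. -/
structure IsContinuousScore (μ : Measure Z) (S : Z → ℝ) : Prop where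
  measurable : Measurable S
  measure_preimage_singleton : ∀ c, μ (S ⁻¹' {c}) = 0
  mem_Icc : ∀ z, S z ∈ Icc (0 : ℝ) 1

theorem IsContinuousScore.ae_mem_Ioo {S : Z → ℝ} (hS : IsContinuousScore μ S) :
    ∀ᵐ z ∂μ, S z ∈ Ioo (0 : ℝ) 1 := by
  filter_upwards [measure_eq_zero_iff_ae_notMem.1 (hS.measure_preimage_singleton 0),
    measure_eq_zero_iff_ae_notMem.1 (hS.measure_preimage_singleton 1)] with z h0 h1
  exact ⟨(hS.mem_Icc z).1.lt_of_ne' h0, (hS.mem_Icc z).2.lt_of_ne h1⟩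

variable [IsProbabilityMeasure μ]

theorem measurePreserving_pi_eval_prodMk {ι : Type*} [Fintype ι] {i j : ι} (hij : i ≠ j) :
    MeasurePreserving (fun ω : ι → Z => (ω i, ω j)) (Measure.pi fun _ => μ) (μ.prod μ) := by
  refine ⟨by fun_prop, ?_⟩
  have hind : IndepFun (fun ω : ι → Z => ω i) (fun ω => ω j) (Measure.pi fun _ => μ) :=
    (iIndepFun_pi (μ := fun _ : ι => μ) (X := fun _ => id) fun _ => aemeasurable_id).indepFun hij
  rw [(indepFun_iff_map_prod_eq_prod_map_map (measurable_pi_apply i).aemeasurable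
      (measurable_pi_apply j).aemeasurable).1 hind,
    (measurePreserving_eval (fun _ : ι => μ) i).map_eq,
    (measurePreserving_eval (fun _ : ι => μ) j).map_eq]

theorem ae_pi_injective {ι : Type*} [Fintype ι] {f : ι → Z → ℝ} (hf : ∀ i, Measurable (f i))
    (hnull : ∀ i c, μ (f i ⁻¹' {c}) = 0) :
    ∀ᵐ ω ∂(Measure.pi fun _ : ι => μ), Function.Injective fun i => f i (ω i) := by
  have hne : ∀ i j, i ≠ j → ∀ᵐ ω ∂(Measure.pi fun _ : ι => μ), f i (ω i) ≠ f j (ω j) := by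
    intro i j hij
    have hmeas : MeasurableSet {x : Z × Z | f i x.1 ≠ f j x.2} :=
      (measurableSet_eq_fun ((hf i).comp measurable_fst) ((hf j).comp measurable_snd)).compl
    refine (measurePreserving_pi_eval_prodMk hij).quasiMeasurePreserving.ae
      (p := fun x : Z × Z => f i x.1 ≠ f j x.2) ((Measure.ae_prod_iff_ae_ae hmeas).2 ?_)
    refine ae_of_all _ fun x => ?_
    filter_upwards [measure_eq_zero_iff_ae_notMem.1 (hnull j (f i x))] with y hy using Ne.symm hy
  have hall : ∀ᵐ ω ∂(Measure.pi fun _ : ι => μ), ∀ i j, i ≠ j → f i (ω i) ≠ f j (ω j) := by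
    simpa only [Filter.eventually_all, Filter.eventually_imp_distrib_left] using hne
  filter_upwards [hall] with ω hω i j hij
  exact by_contra fun h => hω i j h hij

theorem IsContinuousScore.ae_noTies {S : Z → ℝ} (hS : IsContinuousScore μ S) (n : ℕ) :
    ∀ᵐ ω ∂(Measure.pi fun _ : Fin n => μ), NoTies (S ∘ ω) := by
  filter_upwards [ae_pi_injective (ι := Fin n) (fun _ => hS.measurable)
    fun _ => hS.measure_preimage_singleton, ae_all_iff.2 fun i : Fin n =>
      (measurePreserving_eval (fun _ => μ) i).quasiMeasurePreserving.ae hS.ae_mem_Ioo]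
    with ω hinj hmem
  exact ⟨hinj, hmem⟩

end ContinuousScores

section Resampling

open Function

theorem innerIndices_updateFinset_eq_iff {n l u : ℕ} {s : Fin n → ℝ} {M : Finset (Fin n)}
    (hM : innerIndices l u s = M) (x : M → ℝ) :
    innerIndices l u (updateFinset s M x) = M ↔
      ∀ i, x i ∈ Ioo (blockEnds l u s).1 (blockEnds l u s).2 := by
  subst hM
  rw [innerIndices_eq_iff_of_eqOn_compl fun i hi => by simp [updateFinset, hi], Subtype.forall]
  simp +contextual [updateFinset]

theorem blockEnds_updateFinset {n l u : ℕ} {s : Fin n → ℝ} {M : Finset (Fin n)}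
    (hM : innerIndices l u s = M) {x : M → ℝ} (hx : innerIndices l u (updateFinset s M x) = M) :
    blockEnds l u (updateFinset s M x) = blockEnds l u s := by
  subst hM
  exact blockEnds_eq_of_innerIndices_eq (fun i hi => by simp [updateFinset, hi]) hx

theorem comp_updateFinset {ι α β : Type*} [DecidableEq ι] (f : α → β) (ω : ι → α) (M : Finset ι)
    (x : M → α) : f ∘ updateFinset ω M x = updateFinset (f ∘ ω) M (f ∘ x) := by
  funext i
  simp only [updateFinset_def, comp_apply, apply_dite f]

theorem updateFinset_updateFinset {ι α : Type*} [DecidableEq ι] (ω : ι → α) (M : Finset ι)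
    (x x' : M → α) : updateFinset (updateFinset ω M x) M x' = updateFinset ω M x' := by
  funext i
  by_cases hi : i ∈ M <;> simp [updateFinset, hi]

theorem indicator_innerIndices_eq_updateFinset {n l u : ℕ} {Z : Type*} {S : Z → ℝ}
    {ω : Fin n → Z} {M : Finset (Fin n)} (hM : innerIndices l u (S ∘ ω) = M)
    (F : ℝ × ℝ → (M → Z) → ENNReal) (x : M → Z) :
    {ω | innerIndices l u (S ∘ ω) = M}.indicator
        (fun ω => F (blockEnds l u (S ∘ ω)) (M.restrict ω)) (updateFinset ω M x) =
      (univ.pi fun _ => S ⁻¹' Ioo (blockEnds l u (S ∘ ω)).1 (blockEnds l u (S ∘ ω)).2).indicator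
        (F (blockEnds l u (S ∘ ω))) x := by
  have hmem : updateFinset ω M x ∈ {ω | innerIndices l u (S ∘ ω) = M} ↔
      x ∈ univ.pi fun _ => S ⁻¹' Ioo (blockEnds l u (S ∘ ω)).1 (blockEnds l u (S ∘ ω)).2 := by
    rw [mem_ofPred_eq, comp_updateFinset, innerIndices_updateFinset_eq_iff hM, mem_univ_pi]
    rfl
  by_cases hx : updateFinset ω M x ∈ {ω | innerIndices l u (S ∘ ω) = M}
  · rw [indicator_of_mem hx, indicator_of_mem (hmem.1 hx)]
    rw [mem_ofPred_eq, comp_updateFinset] at hx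
    rw [comp_updateFinset, blockEnds_updateFinset hM hx, restrict_updateFinset]
  · rw [indicator_of_notMem hx, indicator_of_notMem (mt hmem.2 hx)]

variable {Z : Type*} [MeasurableSpace Z]

theorem measurable_comp_sample {n : ℕ} {S : Z → ℝ} (hS : Measurable S) :
    Measurable fun ω : Fin n → Z => S ∘ ω :=
  measurable_pi_lambda _ fun i => hS.comp (measurable_pi_apply i)

variable {μ : Measure Z} [IsProbabilityMeasure μ]

theorem cond_univ_pi {ι : Type*} [Fintype ι] {J : Set Z} (hJ : MeasurableSet J) :
    (Measure.pi fun _ : ι => μ)[|univ.pi fun _ => J] = Measure.pi fun _ : ι => μ[|J] := by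
  refine (Measure.pi_eq fun s _ => ?_).symm
  rw [cond_apply (MeasurableSet.univ_pi fun _ => hJ), ← Set.pi_inter_distrib, Measure.pi_pi,
    Measure.pi_pi, ENNReal.prod_inv_distrib fun _ _ _ _ _ => Or.inr (measure_ne_top μ J),
    ← Finset.prod_mul_distrib]
  simp only [cond_apply hJ]

theorem setLIntegral_univ_pi_le {ι : Type*} [Fintype ι] [Nonempty ι] {J : Set Z}
    (hJ : MeasurableSet J) {F : (ι → Z) → ENNReal} {c : ENNReal}
    (h : μ J ≠ 0 → ∫⁻ x, F x ∂(Measure.pi fun _ : ι => μ[|J]) ≤ c) :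
    ∫⁻ x in univ.pi fun _ => J, F x ∂(Measure.pi fun _ : ι => μ) ≤
      c * (Measure.pi fun _ : ι => μ) (univ.pi fun _ => J) := by
  rcases eq_or_ne (μ J) 0 with h0 | h0
  · have hbox : (Measure.pi fun _ : ι => μ) (univ.pi fun _ => J) = 0 := by
      simp [Measure.pi_pi, h0]
    rw [setLIntegral_measure_zero _ _ hbox, hbox, mul_zero]
  · have hbox : (Measure.pi fun _ : ι => μ) (univ.pi fun _ => J) ≠ 0 := by
      simp [Measure.pi_pi, h0]
    have hF := h h0
    rw [← cond_univ_pi hJ, ProbabilityTheory.cond, lintegral_smul_measure, smul_eq_mul, mul_comm,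
      ← div_eq_mul_inv, ENNReal.div_le_iff hbox (measure_ne_top _ _)] at hF
    exact hF

/-- Conditionally on the set `M` of inner indices, on the ends of the block and on all points
outside of it, the points of the block are independent draws from the law of a test point
conditioned to fall into the block. -/
theorem setLIntegral_innerIndices_eq_le {n l u : ℕ} {S : Z → ℝ} (hS : Measurable S)
    {M : Finset (Fin n)} (hM : M.Nonempty) {F : ℝ × ℝ → (M → Z) → ENNReal}
    (hF : Measurable (uncurry F)) {c : ℝ × ℝ → ENNReal} (hc : Measurable c)
    (h : ∀ e : ℝ × ℝ, μ (S ⁻¹' Ioo e.1 e.2) ≠ 0 →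
      ∫⁻ x, F e x ∂(Measure.pi fun _ : M => μ[|S ⁻¹' Ioo e.1 e.2]) ≤ c e) :
    ∫⁻ ω in {ω | innerIndices l u (S ∘ ω) = M}, F (blockEnds l u (S ∘ ω)) (M.restrict ω)
        ∂(Measure.pi fun _ => μ) ≤
      ∫⁻ ω in {ω | innerIndices l u (S ∘ ω) = M}, c (blockEnds l u (S ∘ ω))
        ∂(Measure.pi fun _ => μ) := by
  have hSω := measurable_comp_sample (n := n) hS
  have hE : MeasurableSet {ω : Fin n → Z | innerIndices l u (S ∘ ω) = M} :=
    hSω (measurableSet_innerIndices_eq l u M)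
  have hends : Measurable fun ω : Fin n → Z => blockEnds l u (S ∘ ω) :=
    (measurable_blockEnds l u).comp hSω
  have hFω : Measurable fun ω => F (blockEnds l u (S ∘ ω)) (M.restrict ω) :=
    hF.comp (hends.prodMk (Finset.measurable_restrict M))
  rw [← lintegral_indicator hE, ← lintegral_indicator hE]
  refine lintegral_le_of_lmarginal_le M (hFω.indicator hE) ((hc.comp hends).indicator hE)
    fun ω => ?_
  by_cases hω : ∃ x, innerIndices l u (S ∘ updateFinset ω M x) = M
  · obtain ⟨ω', hω', hM'⟩ : ∃ ω', (∀ x, updateFinset ω M x = updateFinset ω' M x) ∧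
        innerIndices l u (S ∘ ω') = M :=
      hω.imp' (updateFinset ω M) fun x₀ hx₀ =>
        ⟨fun x => (updateFinset_updateFinset ω M x₀ x).symm, hx₀⟩
    have : Nonempty M := hM.to_subtype
    have hJ := hS (measurableSet_Ioo (a := (blockEnds l u (S ∘ ω')).1)
      (b := (blockEnds l u (S ∘ ω')).2))
    simp only [lmarginal, hω', indicator_innerIndices_eq_updateFinset hM',
      indicator_innerIndices_eq_updateFinset hM' fun e _ => c e,
      lintegral_indicator (MeasurableSet.univ_pi fun _ => hJ), setLIntegral_const]
    exact setLIntegral_univ_pi_le hJ (h (blockEnds l u (S ∘ ω')))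
  · push Not at hω
    simp [lmarginal, hω]

end Resampling

section Blocks

open Function

variable {n : ℕ} {Z : Type*}

/-- The points whose score lies in the half-open interval with the given ends. -/
def scoreCell (S : Z → ℝ) (e : ℝ × ℝ) : Set Z := S ⁻¹' Ico e.1 e.2

/-- The mean of `Y` over the points of the sample `ω` whose scores lie strictly between the `l`-th
and the `u`-th order statistics. -/
def blockMean (S Y : Z → ℝ) (l u : ℕ) (ω : Fin n → Z) : ℝ :=
  (∑ i ∈ innerIndices l u (S ∘ ω), Y (ω i)) / (innerIndices l u (S ∘ ω)).card

theorem blockMean_mem_Icc {S Y : Z → ℝ} (hY01 : ∀ z, Y z ∈ Icc (0 : ℝ) 1) (l u : ℕ)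
    (ω : Fin n → Z) : blockMean S Y l u ω ∈ Icc (0 : ℝ) 1 := by
  have hsum : ∑ i ∈ innerIndices l u (S ∘ ω), Y (ω i) ≤ (innerIndices l u (S ∘ ω)).card := by
    simpa using Finset.sum_le_card_nsmul (innerIndices l u (S ∘ ω)) _ 1 fun i _ => (hY01 (ω i)).2
  exact ⟨div_nonneg (Finset.sum_nonneg fun i _ => (hY01 (ω i)).1) (Nat.cast_nonneg _),
    div_le_one_of_le₀ hsum (Nat.cast_nonneg _)⟩

variable [MeasurableSpace Z] {μ : Measure Z} {S Y : Z → ℝ}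

/-- The error of `blockMean` as an estimate of the mean of `Y` conditionally on the event that an
independent draw from `μ` falls into the same block. -/
def blockError (μ : Measure Z) (S Y : Z → ℝ) (l u : ℕ) (ω : Fin n → Z) : ℝ :=
  blockMean S Y l u ω - ∫ z, Y z ∂μ[|scoreCell S (blockEnds l u (S ∘ ω))]

theorem measurableSet_scoreCell (hS : Measurable S) (e : ℝ × ℝ) :
    MeasurableSet (scoreCell S e) :=
  hS measurableSet_Ico

theorem measurableSet_prod_scoreCell (hS : Measurable S) :
    MeasurableSet {x : (ℝ × ℝ) × Z | x.2 ∈ scoreCell S x.1} := by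
  have hle : MeasurableSet {x : (ℝ × ℝ) × Z | x.1.1 ≤ S x.2} :=
    measurableSet_le (by fun_prop) (by fun_prop)
  have hlt : MeasurableSet {x : (ℝ × ℝ) × Z | S x.2 < x.1.2} :=
    measurableSet_lt (by fun_prop) (by fun_prop)
  exact hle.inter hlt

theorem measurableSet_mem_scoreCell_blockEnds (hS : Measurable S) (l u : ℕ) :
    MeasurableSet {x : (Fin n → Z) × Z | x.2 ∈ scoreCell S (blockEnds l u (S ∘ x.1))} :=
  (measurableSet_prod_scoreCell hS).preimage <|
    ((measurable_blockEnds l u).comp ((measurable_comp_sample hS).comp measurable_fst)).prodMk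
      measurable_snd

theorem measurable_measure_scoreCell [SFinite μ] (hS : Measurable S) :
    Measurable fun e => μ (scoreCell S e) :=
  measurable_measure_prodMk_left (measurableSet_prod_scoreCell hS)

theorem measurable_integral_cond_scoreCell [SFinite μ] (hS : Measurable S) (hY : Measurable Y) :
    Measurable fun e => ∫ z, Y z ∂μ[|scoreCell S e] := by
  have hcell : ∀ e, ∫ z, Y z ∂μ[|scoreCell S e] =
      (μ (scoreCell S e))⁻¹.toReal *
        ∫ z, {x : (ℝ × ℝ) × Z | x.2 ∈ scoreCell S x.1}.indicator (fun x => Y x.2) (e, z) ∂μ := by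
    intro e
    rw [ProbabilityTheory.cond, integral_smul_measure, smul_eq_mul,
      ← integral_indicator (measurableSet_scoreCell hS e)]
    rfl
  simp only [hcell]
  refine (measurable_measure_scoreCell hS).inv.ennreal_toReal.mul ?_
  exact ((hY.comp measurable_snd).indicator
    (measurableSet_prod_scoreCell hS)).stronglyMeasurable.integral_prod_right'.measurable

theorem measurable_blockMean (hS : Measurable S) (hY : Measurable Y) (l u : ℕ) :
    Measurable (blockMean (n := n) S Y l u) := by
  have hmem : ∀ i, MeasurableSet {ω : Fin n → Z | i ∈ innerIndices l u (S ∘ ω)} := fun i =>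
    (measurableSet_mem_innerIndices l u i).preimage (measurable_comp_sample hS)
  have heq : blockMean (n := n) S Y l u = fun ω =>
      (∑ i, if i ∈ innerIndices l u (S ∘ ω) then Y (ω i) else 0) /
        ∑ i, if i ∈ innerIndices l u (S ∘ ω) then 1 else 0 := by
    funext ω
    simp [blockMean]
  rw [heq]
  refine (Finset.measurable_sum _ fun i _ => ?_).div (Finset.measurable_sum _ fun i _ => ?_)
  · exact Measurable.ite (hmem i) (hY.comp (measurable_pi_apply i)) measurable_const
  · exact Measurable.ite (hmem i) measurable_const measurable_const

theorem measurable_blockError [SFinite μ] (hS : Measurable S) (hY : Measurable Y) (l u : ℕ) :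
    Measurable (blockError (n := n) μ S Y l u) :=
  (measurable_blockMean hS hY l u).sub ((measurable_integral_cond_scoreCell hS hY).comp
    ((measurable_blockEnds l u).comp (measurable_comp_sample hS)))

theorem IsContinuousScore.cond_preimage_Ioo (hS : IsContinuousScore μ S) (e : ℝ × ℝ) :
    μ[|S ⁻¹' Ioo e.1 e.2] = μ[|scoreCell S e] := by
  have hae : S ⁻¹' Ioo e.1 e.2 =ᵐ[μ] scoreCell S e := by
    filter_upwards [measure_eq_zero_iff_ae_notMem.1 (hS.measure_preimage_singleton e.1)] with z hz
    refine propext (and_congr_left fun _ => ?_)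
    exact ⟨le_of_lt, fun hle => lt_of_le_of_ne hle (Ne.symm hz)⟩
  rw [ProbabilityTheory.cond, ProbabilityTheory.cond, measure_congr hae,
    Measure.restrict_congr_set hae]

theorem lintegral_eq_sum_setLIntegral_fiber {α κ : Type*} [MeasurableSpace α] [Fintype κ]
    {ν : Measure α} {f : α → κ} (hf : ∀ k, MeasurableSet {a | f a = k}) (F : α → ENNReal) :
    ∫⁻ a, F a ∂ν = ∑ k, ∫⁻ a in {a | f a = k}, F a ∂ν := by
  have huniv : ⋃ k, {a | f a = k} = univ := by ext; simp
  rw [← setLIntegral_univ, ← huniv, lintegral_iUnion hf, tsum_fintype]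
  exact fun j k hjk => Set.disjoint_left.2 fun a hj hk => hjk (hj.symm.trans hk)

variable [IsProbabilityMeasure μ]

theorem setLIntegral_blockError_le (hS : IsContinuousScore μ S) (hY : Measurable Y) {l u : ℕ}
    {w : ℝ × ℝ → ENNReal} (hw : Measurable w) {φ : ℝ → ENNReal} (hφ : Measurable φ)
    {C : ENNReal} {M : Finset (Fin n)} (hM : M.Nonempty)
    (hC : ∀ (ν : Measure Z) [IsProbabilityMeasure ν],
      ∫⁻ x, φ ((∑ i, Y (x i)) / M.card - ∫ z, Y z ∂ν) ∂(Measure.pi fun _ : M => ν) ≤ C) :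
    ∫⁻ ω in {ω | innerIndices l u (S ∘ ω) = M},
        w (blockEnds l u (S ∘ ω)) * φ (blockError μ S Y l u ω) ∂(Measure.pi fun _ => μ) ≤
      ∫⁻ ω in {ω | innerIndices l u (S ∘ ω) = M}, w (blockEnds l u (S ∘ ω)) * C
        ∂(Measure.pi fun _ => μ) := by
  set F : ℝ × ℝ → (M → Z) → ENNReal := fun e x =>
    w e * φ ((∑ i, Y (x i)) / M.card - ∫ z, Y z ∂μ[|scoreCell S e]) with hFdef
  have hφM : Measurable fun q : (ℝ × ℝ) × (M → Z) =>
      φ ((∑ i, Y (q.2 i)) / M.card - ∫ z, Y z ∂μ[|scoreCell S q.1]) := by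
    have hcond : Measurable fun q : (ℝ × ℝ) × (M → Z) => ∫ z, Y z ∂μ[|scoreCell S q.1] :=
      (measurable_integral_cond_scoreCell hS.measurable hY).comp measurable_fst
    exact hφ.comp (Measurable.sub (by fun_prop) hcond)
  have hF : Measurable (uncurry F) := (hw.comp measurable_fst).mul hφM
  have hE : MeasurableSet {ω : Fin n → Z | innerIndices l u (S ∘ ω) = M} :=
    measurable_comp_sample hS.measurable (measurableSet_innerIndices_eq l u M)
  calc _ = ∫⁻ ω in {ω | innerIndices l u (S ∘ ω) = M}, F (blockEnds l u (S ∘ ω)) (M.restrict ω)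
        ∂(Measure.pi fun _ => μ) := by
        refine setLIntegral_congr_fun hE fun ω (hω : innerIndices l u (S ∘ ω) = M) => ?_
        simp only [hFdef, blockError, blockMean, hω, Finset.restrict, Finset.sum_coe_sort M
          fun i => Y (ω i)]
    _ ≤ _ := by
        refine setLIntegral_innerIndices_eq_le hS.measurable hM hF (hw.mul_const C) fun e he => ?_
        have := cond_isProbabilityMeasure he
        refine (lintegral_const_mul (w e) (hφM.comp measurable_prodMk_left)).le.trans ?_
        simp only [comp_apply, ← hS.cond_preimage_Ioo]
        exact mul_le_mul_right (hC _) _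

theorem lintegral_blockError_le (hS : IsContinuousScore μ S) (hY : Measurable Y) {l u : ℕ}
    (hlu : l + 1 < u) (hu : u ≤ n + 1) {w : ℝ × ℝ → ENNReal} (hw : Measurable w)
    {φ : ℝ → ENNReal} (hφ : Measurable φ) {C : ENNReal}
    (hC : ∀ (ν : Measure Z) [IsProbabilityMeasure ν] (M : Finset (Fin n)),
      M.card = (Finset.Ioo l u).card →
        ∫⁻ x, φ ((∑ i, Y (x i)) / M.card - ∫ z, Y z ∂ν) ∂(Measure.pi fun _ : M => ν) ≤ C) :
    ∫⁻ ω : Fin n → Z, w (blockEnds l u (S ∘ ω)) * φ (blockError μ S Y l u ω)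
        ∂(Measure.pi fun _ => μ) ≤
      (∫⁻ ω : Fin n → Z, w (blockEnds l u (S ∘ ω)) ∂(Measure.pi fun _ => μ)) * C := by
  have hE : ∀ M, MeasurableSet {ω : Fin n → Z | innerIndices l u (S ∘ ω) = M} := fun M =>
    measurable_comp_sample hS.measurable (measurableSet_innerIndices_eq l u M)
  have hwm : Measurable fun ω : Fin n → Z => w (blockEnds l u (S ∘ ω)) :=
    hw.comp ((measurable_blockEnds l u).comp (measurable_comp_sample hS.measurable))
  rw [← lintegral_mul_const C hwm,
    lintegral_eq_sum_setLIntegral_fiber hE, lintegral_eq_sum_setLIntegral_fiber hE]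
  refine Finset.sum_le_sum fun M _ => ?_
  by_cases hM : M.card = (Finset.Ioo l u).card
  · have hpos : 0 < M.card := by rw [hM, Nat.card_Ioo]; omega
    exact setLIntegral_blockError_le hS hY hw hφ (Finset.card_pos.1 hpos) fun ν _ => hC ν M hM
  · have hnull : (Measure.pi fun _ => μ) {ω : Fin n → Z | innerIndices l u (S ∘ ω) = M} = 0 := by
      refine measure_eq_zero_iff_ae_notMem.2 ?_
      filter_upwards [hS.ae_noTies n] with ω hω hωM
      exact hM (hωM ▸ hω.card_innerIndices (by omega) hu)
    rw [setLIntegral_measure_zero _ _ hnull, setLIntegral_measure_zero _ _ hnull]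

end Blocks

section Concentration

open scoped NNReal

theorem measureReal_abs_ge_le_of_hasSubgaussianMGF {Ω : Type*} [MeasurableSpace Ω]
    {μ : Measure Ω} {X : Ω → ℝ} {c : ℝ≥0} (h : HasSubgaussianMGF X c μ) {ε : ℝ} (hε : 0 ≤ ε) :
    μ.real {ω | ε ≤ |X ω|} ≤ 2 * Real.exp (-ε ^ 2 / (2 * c)) := by
  have hunion : {ω | ε ≤ |X ω|} = {ω | ε ≤ X ω} ∪ {ω | ε ≤ (-X) ω} := by
    ext ω
    exact le_abs (a := ε) (b := X ω)
  calc μ.real {ω | ε ≤ |X ω|} ≤ μ.real {ω | ε ≤ X ω} + μ.real {ω | ε ≤ (-X) ω} := by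
        rw [hunion]
        exact measureReal_union_le _ _
    _ ≤ Real.exp (-ε ^ 2 / (2 * c)) + Real.exp (-ε ^ 2 / (2 * c)) :=
        add_le_add (h.measure_ge_le hε) (h.neg.measure_ge_le hε)
    _ = 2 * Real.exp (-ε ^ 2 / (2 * c)) := (two_mul _).symm

variable {ι Z : Type*} [Fintype ι] [Nonempty ι] [MeasurableSpace Z] {ν : Measure Z}
  [IsProbabilityMeasure ν] {Y : Z → ℝ}

theorem measure_abs_mean_sub_ge_le (hY : Measurable Y) (hY01 : ∀ z, Y z ∈ Icc (0 : ℝ) 1)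
    {ε : ℝ} (hε : 0 ≤ ε) :
    (Measure.pi fun _ : ι => ν) {x | ε ≤ |(∑ i, Y (x i)) / Fintype.card ι - ∫ z, Y z ∂ν|} ≤
      ENNReal.ofReal (2 * Real.exp (-(2 * Fintype.card ι * ε ^ 2))) := by
  have hN : (0 : ℝ) < Fintype.card ι := by exact_mod_cast Fintype.card_pos
  have hsub : HasSubgaussianMGF (fun z => Y z - ∫ z, Y z ∂ν) ((‖(1 : ℝ) - 0‖₊ / 2) ^ 2) ν :=
    hasSubgaussianMGF_of_mem_Icc hY.aemeasurable (ae_of_all _ hY01)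
  have hsum : HasSubgaussianMGF (fun x : ι → Z => ∑ i, (Y (x i) - ∫ z, Y z ∂ν))
      (∑ _i : ι, (‖(1 : ℝ) - 0‖₊ / 2) ^ 2) (Measure.pi fun _ => ν) := by
    refine HasSubgaussianMGF.sum_of_iIndepFun
      (iIndepFun_pi (X := fun _ z => Y z - ∫ z, Y z ∂ν) fun _ => by fun_prop) fun i _ => ?_
    refine HasSubgaussianMGF.of_map (X := fun z => Y z - ∫ z, Y z ∂ν)
      (measurable_pi_apply i).aemeasurable ?_
    rwa [(measurePreserving_eval (fun _ : ι => ν) i).map_eq]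
  have hset : {x : ι → Z | ε ≤ |(∑ i, Y (x i)) / Fintype.card ι - ∫ z, Y z ∂ν|} =
      {x | Fintype.card ι * ε ≤ |∑ i, (Y (x i) - ∫ z, Y z ∂ν)|} := by
    ext x
    have hmean : (∑ i, Y (x i)) / Fintype.card ι - ∫ z, Y z ∂ν =
        (∑ i, (Y (x i) - ∫ z, Y z ∂ν)) / Fintype.card ι := by
      rw [Finset.sum_sub_distrib, Finset.sum_const, Finset.card_univ, nsmul_eq_mul]
      field_simp
    rw [mem_ofPred_eq, mem_ofPred_eq, hmean, abs_div, abs_of_pos hN, le_div_iff₀' hN]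
  rw [hset, ← ofReal_measureReal]
  refine ENNReal.ofReal_le_ofReal
    ((measureReal_abs_ge_le_of_hasSubgaussianMGF hsum (by positivity)).trans_eq ?_)
  congr 2
  push_cast [Finset.sum_const, Finset.card_univ, nsmul_eq_mul, sub_zero, nnnorm_one]
  field_simp

theorem lintegral_sq_mean_sub_le (hY : Measurable Y) (hY01 : ∀ z, Y z ∈ Icc (0 : ℝ) 1) :
    ∫⁻ x, ENNReal.ofReal (((∑ i, Y (x i)) / Fintype.card ι - ∫ z, Y z ∂ν) ^ 2)
        ∂(Measure.pi fun _ : ι => ν) ≤ ENNReal.ofReal (1 / (4 * Fintype.card ι)) := by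
  have : (0 : ℝ) < Fintype.card ι := by exact_mod_cast Fintype.card_pos
  have hmem : MemLp Y 2 ν := memLp_of_bounded (ae_of_all _ hY01) hY.aestronglyMeasurable 2
  have hmem' : ∀ i, MemLp (fun x : ι → Z => Y (x i)) 2 (Measure.pi fun _ => ν) := fun i =>
    hmem.comp_measurePreserving (measurePreserving_eval (fun _ : ι => ν) i)
  have hsum : MemLp (fun x : ι → Z => ∑ i, Y (x i)) 2 (Measure.pi fun _ => ν) :=
    memLp_finsetSum _ fun i _ => hmem' i
  set X : (ι → Z) → ℝ := fun x => (∑ i, Y (x i)) / Fintype.card ι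
  have hX : MemLp X 2 (Measure.pi fun _ => ν) := by
    simpa only [X, div_eq_mul_inv] using hsum.mul_const _
  have hmean : ∫ x, X x ∂(Measure.pi fun _ => ν) = ∫ z, Y z ∂ν := by
    simp only [X, integral_div,
      integral_finsetSum _ fun i _ => (hmem' i).integrable (by norm_num : (1 : ENNReal) ≤ 2),
      integral_comp_eval (μ := fun _ : ι => ν) hY.aestronglyMeasurable, Finset.sum_const,
      Finset.card_univ, nsmul_eq_mul]
    field_simp
  have hvar : Var[X; Measure.pi fun _ => ν] ≤ 1 / (4 * Fintype.card ι) := by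
    calc Var[X; Measure.pi fun _ => ν] = (∑ _i : ι, Var[Y; ν]) / (Fintype.card ι : ℝ) ^ 2 := by
          simp only [X, div_eq_mul_inv]
          rw [variance_mul_const, inv_pow, ← variance_sum_pi (X := fun _ => Y) fun _ => hmem,
            ← Finset.sum_fn]
      _ ≤ (∑ _i : ι, ((1 - 0) / 2) ^ 2) / (Fintype.card ι : ℝ) ^ 2 := by
          gcongr
          exact variance_le_sq_of_bounded (ae_of_all _ hY01) hY.aemeasurable
      _ = 1 / (4 * Fintype.card ι) := by
          rw [Finset.sum_const, Finset.card_univ, nsmul_eq_mul]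
          field_simp
          norm_num
  rw [← hmean, ← evariance_eq_lintegral_ofReal, ← ofReal_variance hX]
  exact ENNReal.ofReal_le_ofReal hvar

variable {n : ℕ} {μ : Measure Z} [IsProbabilityMeasure μ] {S : Z → ℝ}

theorem setLIntegral_abs_blockError_ge_le (hS : IsContinuousScore μ S) (hY : Measurable Y)
    (hY01 : ∀ z, Y z ∈ Icc (0 : ℝ) 1) {l u : ℕ} (hlu : l + 1 < u) (hu : u ≤ n + 1)
    {w : ℝ × ℝ → ENNReal} (hw : Measurable w) {ε : ℝ} (hε : 0 ≤ ε) :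
    ∫⁻ ω in {ω : Fin n → Z | ε ≤ |blockError μ S Y l u ω|}, w (blockEnds l u (S ∘ ω))
        ∂(Measure.pi fun _ => μ) ≤
      (∫⁻ ω : Fin n → Z, w (blockEnds l u (S ∘ ω)) ∂(Measure.pi fun _ => μ)) *
        ENNReal.ofReal (2 * Real.exp (-(2 * (Finset.Ioo l u).card * ε ^ 2))) := by
  have hset : MeasurableSet {x : ℝ | ε ≤ |x|} := measurableSet_le measurable_const measurable_abs
  have hωset : MeasurableSet {ω : Fin n → Z | ε ≤ |blockError μ S Y l u ω|} :=
    measurable_blockError hS.measurable hY l u hset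
  calc _ = ∫⁻ ω : Fin n → Z, w (blockEnds l u (S ∘ ω)) *
        {x : ℝ | ε ≤ |x|}.indicator 1 (blockError μ S Y l u ω) ∂(Measure.pi fun _ => μ) := by
        rw [← lintegral_indicator hωset]
        refine lintegral_congr fun ω => ?_
        by_cases hω : ε ≤ |blockError μ S Y l u ω| <;> simp [indicator, hω]
    _ ≤ _ := by
        refine lintegral_blockError_le hS hY hlu hu hw (measurable_one.indicator hset)
          fun ν _ M hM => ?_
        have hne : Nonempty M :=
          (Finset.card_pos.1 (by rw [hM, Nat.card_Ioo]; omega)).to_subtype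
        rw [← hM, ← Fintype.card_coe]
        refine le_of_eq_of_le ?_ (measure_abs_mean_sub_ge_le (ν := ν) hY hY01 hε)
        rw [← lintegral_indicator_one (measurableSet_le measurable_const (by fun_prop))]
        rfl

theorem lintegral_sq_blockError_le (hS : IsContinuousScore μ S) (hY : Measurable Y)
    (hY01 : ∀ z, Y z ∈ Icc (0 : ℝ) 1) {l u : ℕ} (hlu : l + 1 < u) (hu : u ≤ n + 1)
    {w : ℝ × ℝ → ENNReal} (hw : Measurable w) :
    ∫⁻ ω : Fin n → Z, w (blockEnds l u (S ∘ ω)) * ENNReal.ofReal (blockError μ S Y l u ω ^ 2)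
        ∂(Measure.pi fun _ => μ) ≤
      (∫⁻ ω : Fin n → Z, w (blockEnds l u (S ∘ ω)) ∂(Measure.pi fun _ => μ)) *
        ENNReal.ofReal (1 / (4 * (Finset.Ioo l u).card)) := by
  refine lintegral_blockError_le (φ := fun x => ENNReal.ofReal (x ^ 2)) hS hY hlu hu hw
    (by fun_prop) fun ν _ M hM => ?_
  have hne : Nonempty M := (Finset.card_pos.1 (by rw [hM, Nat.card_Ioo]; omega)).to_subtype
  rw [← hM, ← Fintype.card_coe]
  exact lintegral_sq_mean_sub_le hY hY01

end Concentration

section ExpectedMass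

variable {n : ℕ}

theorem card_le_removeNth_add_one (s : Fin (n + 1) → ℝ) (i : Fin (n + 1)) :
    (Finset.univ.filter fun k => i.removeNth s k ≤ s i).card + 1 =
      (Finset.univ.filter fun k => s k ≤ s i).card := by
  rw [Finset.card_filter, Finset.card_filter, Fin.sum_univ_succAbove _ i, if_pos le_rfl, add_comm]
  rfl

theorem injective_card_le_removeNth {s : Fin (n + 1) → ℝ} (hs : Function.Injective s) :
    Function.Injective fun i => (Finset.univ.filter fun k => i.removeNth s k ≤ s i).card := by
  have hlt : ∀ i j, s i < s j → (Finset.univ.filter fun k => s k ≤ s i).card <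
      (Finset.univ.filter fun k => s k ≤ s j).card := by
    intro i j hij
    refine Finset.card_lt_card (Finset.ssubset_iff_of_subset ?_ |>.2 ⟨j, ?_, ?_⟩)
    · exact Finset.monotone_filter_right _ fun k _ hk => hk.trans hij.le
    · simp
    · simpa using hij
  intro i j hij
  have hcard : (Finset.univ.filter fun k => s k ≤ s i).card =
      (Finset.univ.filter fun k => s k ≤ s j).card := by
    rw [← card_le_removeNth_add_one, ← card_le_removeNth_add_one]
    exact congrArg (· + 1) hij
  by_contra hne
  rcases (hs.ne hne).lt_or_gt with h | h
  · exact (hlt i j h).ne hcard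
  · exact (hlt j i h).ne' hcard

theorem card_le_mem_Ico_of_mem_Ico_blockEnds {s : Fin n → ℝ} (hs : ∀ i, s i ∈ Icc (0 : ℝ) 1)
    {l u : ℕ} {x : ℝ} (hx0 : 0 ≤ x) (hx : x ∈ Ico (blockEnds l u s).1 (blockEnds l u s).2) :
    (Finset.univ.filter fun i => s i ≤ x).card ∈ Finset.Ico l u := by
  have hx01 : x ∈ Ico (0 : ℝ) 1 := ⟨hx0, hx.2.trans_le (orderStat_mem_Icc hs u).2⟩
  rw [Finset.mem_Ico, ← orderStat_le_iff s l hx01, ← not_le, ← orderStat_le_iff s u hx01, not_le]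
  exact hx

variable {Z : Type*} [MeasurableSpace Z] {μ : Measure Z}

theorem lintegral_sum_removeNth [SigmaFinite μ] {F : Z × (Fin n → Z) → ENNReal}
    (hF : Measurable F) :
    ∫⁻ ω : Fin (n + 1) → Z, ∑ i, F (ω i, i.removeNth ω) ∂(Measure.pi fun _ => μ) =
      (n + 1) * ∫⁻ x, F x ∂(μ.prod (Measure.pi fun _ => μ)) := by
  have hpres := measurePreserving_piFinSuccAbove (fun _ : Fin (n + 1) => μ)
  have hterm : ∀ i : Fin (n + 1), Measurable fun ω : Fin (n + 1) → Z => F (ω i, i.removeNth ω) :=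
    fun i => hF.comp (hpres i).measurable
  have hint : ∀ i : Fin (n + 1), ∫⁻ ω, F (ω i, i.removeNth ω) ∂(Measure.pi fun _ => μ) =
      ∫⁻ x, F x ∂(μ.prod (Measure.pi fun _ => μ)) := fun i => (hpres i).lintegral_comp hF
  simp [lintegral_finsetSum _ fun i _ => hterm i, hint]

theorem IsContinuousScore.lintegral_measure_scoreCell_le [IsProbabilityMeasure μ] {S : Z → ℝ}
    (hS : IsContinuousScore μ S) (l u : ℕ) :
    ∫⁻ ω : Fin n → Z, μ (scoreCell S (blockEnds l u (S ∘ ω))) ∂(Measure.pi fun _ => μ) ≤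
      ((u - l : ℕ) : ENNReal) / (n + 1) := by
  set A : Set (Z × (Fin n → Z)) := {x | x.1 ∈ scoreCell S (blockEnds l u (S ∘ x.2))}
  have hA : MeasurableSet A :=
    (measurableSet_mem_scoreCell_blockEnds hS.measurable l u).preimage measurable_swap
  have hmass : ∫⁻ ω : Fin n → Z, μ (scoreCell S (blockEnds l u (S ∘ ω))) ∂(Measure.pi fun _ => μ) =
      ∫⁻ x, A.indicator 1 x ∂(μ.prod (Measure.pi fun _ => μ)) := by
    rw [lintegral_indicator_one hA, Measure.prod_apply_symm hA]
    rfl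
  rw [hmass, ENNReal.le_div_iff_mul_le (by simp) (by simp), mul_comm,
    ← lintegral_sum_removeNth (measurable_one.indicator hA)]
  have hcount : ∀ᵐ ω ∂(Measure.pi fun _ : Fin (n + 1) => μ),
      ∑ i, A.indicator (1 : Z × (Fin n → Z) → ENNReal) (ω i, i.removeNth ω) ≤ (u - l : ℕ) := by
    filter_upwards [hS.ae_noTies (n + 1)] with ω hω
    classical
    simp only [indicator_apply, Pi.one_apply, Finset.sum_boole]
    rw [Nat.cast_le, ← Nat.card_Ico]
    refine Finset.card_le_card_of_injOn
      (fun i => (Finset.univ.filter fun k => i.removeNth (S ∘ ω) k ≤ S (ω i)).card) ?_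
      (injective_card_le_removeNth hω.1).injOn
    intro i hi
    exact card_le_mem_Ico_of_mem_Ico_blockEnds (fun k => hS.mem_Icc _) (hS.mem_Icc _).1
      (Finset.mem_filter.1 hi).2
  exact (lintegral_mono_ae hcount).trans_eq (by simp)

end ExpectedMass

section Partition

theorem sum_indicator_eq_of_pairwise_disjoint {ι Z : Type*} [Fintype ι] {A : ι → Set Z}
    (hA : Pairwise (Function.onFun Disjoint A)) (f : ι → ℝ) {b : ι} {z : Z} (hz : z ∈ A b) :
    ∑ c, (A c).indicator (fun _ => f c) z = f b := by
  rw [Finset.sum_eq_single b, indicator_of_mem hz]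
  · exact fun c _ hcb =>
      indicator_of_notMem (fun hzc => disjoint_left.1 (hA hcb) hzc hz) _
  · simp

variable {ι Z : Type*} [MeasurableSpace Z] {μ : Measure Z} {A : ι → Set Z}

/-- A family of disjoint measurable sets which covers the space up to a `μ`-null set, as the bins
of a predictor do. -/
structure IsAEPartition (μ : Measure Z) (A : ι → Set Z) : Prop where
  measurableSet : ∀ b, MeasurableSet (A b)
  pairwise_disjoint : Pairwise (Function.onFun Disjoint A)
  ae_mem : ∀ᵐ z ∂μ, ∃ b, z ∈ A b

theorem IsAEPartition.ae_mem_and_measure_ne_zero [Countable ι] (hA : IsAEPartition μ A) :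
    ∀ᵐ z ∂μ, ∃ b, z ∈ A b ∧ μ (A b) ≠ 0 := by
  have hnull : ∀ᵐ z ∂μ, ∀ b, μ (A b) = 0 → z ∉ A b :=
    ae_all_iff.2 fun b => by
      by_cases hb : μ (A b) = 0
      · exact (measure_eq_zero_iff_ae_notMem.1 hb).mono fun _ hz _ => hz
      · exact ae_of_all _ fun _ h => absurd h hb
  filter_upwards [hA.ae_mem, hnull] with z ⟨b, hzb⟩ hz
  exact ⟨b, hzb, fun hb => hz b hb hzb⟩

variable [Fintype ι]

theorem IsAEPartition.sum_measure (hA : IsAEPartition μ A) : ∑ b, μ (A b) = μ univ := by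
  have hcover : (⋃ b, A b) =ᵐ[μ] univ :=
    Filter.eventuallyEq_univ.2 (hA.ae_mem.mono fun z hz => mem_iUnion.2 hz)
  rw [← measure_congr hcover, measure_iUnion hA.pairwise_disjoint hA.measurableSet, tsum_fintype]

variable [IsFiniteMeasure μ]

theorem IsAEPartition.integral_eq_sum (hA : IsAEPartition μ A) {F : Z → ℝ} {f : ι → ℝ}
    (hF : ∀ b, μ (A b) ≠ 0 → ∀ z ∈ A b, F z = f b) :
    ∫ z, F z ∂μ = ∑ b, μ.real (A b) * f b := by
  have hFf : F =ᵐ[μ] fun z => ∑ b, (A b).indicator (fun _ => f b) z := by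
    filter_upwards [hA.ae_mem_and_measure_ne_zero] with z ⟨b, hzb, hb⟩
    rw [hF b hb z hzb, sum_indicator_eq_of_pairwise_disjoint hA.pairwise_disjoint f hzb]
  rw [integral_congr_ae hFf, integral_finsetSum _ fun b _ =>
    (integrable_const _).indicator (hA.measurableSet b)]
  exact Finset.sum_congr rfl fun b _ => integral_indicator_const _ (hA.measurableSet b)

end Partition

section Lp

variable {Z : Type*} [MeasurableSpace Z] {μ : Measure Z} [IsProbabilityMeasure μ]

theorem integral_rpow_abs_le_sqrt_integral_sq_add {d f : Z → ℝ} {δ : ℝ}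
    (hd : AEStronglyMeasurable d μ) (hf : MemLp f 2 μ) (hδ : 0 ≤ δ)
    (hdf : ∀ᵐ z ∂μ, |d z| ≤ |f z| + δ) {p : ℝ} (hp : 1 ≤ p) (hp2 : p ≤ 2) :
    (∫ z, |d z| ^ p ∂μ) ^ (1 / p) ≤ √(∫ z, f z ^ 2 ∂μ) + δ := by
  have hp0 : ENNReal.ofReal p ≠ 0 := by simpa using zero_lt_one.trans_le hp
  have hp2' : ENNReal.ofReal p ≤ 2 := by simpa using ENNReal.ofReal_le_ofReal hp2
  have hmono : eLpNorm d 2 μ ≤ eLpNorm ((fun z => |f z|) + fun _ => δ) 2 μ :=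
    eLpNorm_mono_ae_real hdf
  have hadd : eLpNorm ((fun z => |f z|) + fun _ => δ) 2 μ ≤ eLpNorm f 2 μ + ENNReal.ofReal δ := by
    refine (eLpNorm_add_le hf.aestronglyMeasurable.norm aestronglyMeasurable_const
      one_le_two).trans_eq ?_
    rw [eLpNorm_const δ two_ne_zero (IsProbabilityMeasure.ne_zero μ), measure_univ,
      ENNReal.one_rpow, mul_one, Real.enorm_of_nonneg hδ]
    exact congrArg (· + _) (eLpNorm_norm f)
  have hle : eLpNorm d (ENNReal.ofReal p) μ ≤ eLpNorm f 2 μ + ENNReal.ofReal δ :=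
    (eLpNorm_le_eLpNorm_of_exponent_le hp2' hd).trans (hmono.trans hadd)
  have hdp : MemLp d (ENNReal.ofReal p) μ :=
    ⟨hd, hle.trans_lt (ENNReal.add_lt_top.2 ⟨hf.2, ENNReal.ofReal_lt_top⟩)⟩
  rw [hdp.eLpNorm_eq_integral_rpow_norm hp0 ENNReal.ofReal_ne_top,
    hf.eLpNorm_eq_integral_rpow_norm two_ne_zero ENNReal.ofNat_ne_top,
    ← ENNReal.ofReal_add (by positivity) hδ, ENNReal.ofReal_le_ofReal_iff (by positivity),
    ENNReal.toReal_ofReal (by positivity)] at hle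
  simpa [Real.sqrt_eq_rpow] using hle

theorem IsAEPartition.integral_rpow_abs_le_sqrt_sum_add {ι : Type*} [Fintype ι] {A : ι → Set Z}
    (hA : IsAEPartition μ A) {d : Z → ℝ} {e : ι → ℝ} {δ : ℝ} (hd : AEStronglyMeasurable d μ)
    (hδ : 0 ≤ δ) (hde : ∀ b, μ (A b) ≠ 0 → ∀ z ∈ A b, |d z| ≤ |e b| + δ) {p : ℝ} (hp : 1 ≤ p)
    (hp2 : p ≤ 2) :
    (∫ z, |d z| ^ p ∂μ) ^ (1 / p) ≤ √(∑ b, μ.real (A b) * e b ^ 2) + δ := by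
  set f : Z → ℝ := fun z => ∑ b, (A b).indicator (fun _ => e b) z
  have hfe : ∀ {b z}, z ∈ A b → f z = e b :=
    sum_indicator_eq_of_pairwise_disjoint hA.pairwise_disjoint e
  have hfL2 : MemLp f 2 μ := memLp_finsetSum _ fun b _ =>
    memLp_indicator_const 2 (hA.measurableSet b) (e b) (.inr (measure_ne_top μ _))
  have hdf : ∀ᵐ z ∂μ, |d z| ≤ |f z| + δ := by
    filter_upwards [hA.ae_mem_and_measure_ne_zero] with z ⟨b, hzb, hb⟩
    exact (hde b hb z hzb).trans_eq (by rw [hfe hzb])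
  rw [← hA.integral_eq_sum (F := fun z => f z ^ 2) fun b _ z hz => by rw [hfe hz]]
  exact integral_rpow_abs_le_sqrt_integral_sq_add hd hfL2 hδ hdf hp hp2

end Lp

section Predictor

variable {𝒳 : Type*} [MeasurableSpace 𝒳]

theorem measurable_label : Measurable (label : (𝒳 × I) × I → I) :=
  measurable_snd.comp measurable_fst

theorem measurable_prediction {h : 𝒳 × I → ℝ} (hh : Measurable h) :
    Measurable (prediction h) := by
  unfold prediction
  fun_prop

variable {P : Measure (𝒳 × I)} [IsProbabilityMeasure P] {h : 𝒳 × I → ℝ}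

theorem measurable_condMean : Measurable (condMean P h) :=
  (StronglyMeasurable.integral_kernel (κ := condDistrib label (prediction h) (testLaw P))
    (f := fun y : I => (y : ℝ)) measurable_subtype_coe.stronglyMeasurable).measurable

theorem uniformlyCalibrated_iff_ae_prediction (hh : Measurable h) {ε : ℝ} :
    UniformlyCalibrated P h ε ↔
      ∀ᵐ z ∂testLaw P, |condMean P h (prediction h z) - prediction h z| ≤ ε :=
  ae_map_iff (measurable_prediction hh).aemeasurable <|
    measurableSet_le (measurable_condMean.sub measurable_id).abs measurable_const

theorem UniformlyCalibrated.ece_le (hh : Measurable h) {ε : ℝ} (hε : 0 ≤ ε)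
    (hcal : UniformlyCalibrated P h ε) {p : ℝ} (hp : 0 < p) : ece P h p ≤ ε := by
  have hint : ∫ z, |condMean P h (prediction h z) - prediction h z| ^ p ∂testLaw P ≤ ε ^ p := by
    calc _ ≤ ∫ _, ε ^ p ∂testLaw P := by
          refine integral_mono_of_nonneg (ae_of_all _ fun z => by positivity)
            (integrable_const _) ?_
          filter_upwards [(uniformlyCalibrated_iff_ae_prediction hh).1 hcal] with z hz
          exact Real.rpow_le_rpow (abs_nonneg _) hz hp.le
      _ = ε ^ p := by simp
  calc ece P h p ≤ (ε ^ p) ^ (1 / p) :=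
        Real.rpow_le_rpow (integral_nonneg fun z => by positivity) hint (by positivity)
    _ = ε := by rw [one_div, Real.rpow_rpow_inv hε hp.ne']

theorem IsAEPartition.condMean_eq {ι : Type*} {A : ι → Set ((𝒳 × I) × I)}
    (hA : IsAEPartition (testLaw P) A) (hh : Measurable h) {v : ι → ℝ}
    (hv : Function.Injective v) (hval : ∀ b, ∀ z ∈ A b, prediction h z = v b) {b : ι}
    (hb : testLaw P (A b) ≠ 0) :
    condMean P h (v b) = ∫ z, (label z : ℝ) ∂(testLaw P)[|A b] := by
  have hp := measurable_prediction hh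
  have hfiber : prediction h ⁻¹' {v b} =ᵐ[testLaw P] A b := by
    filter_upwards [hA.ae_mem] with z ⟨c, hc⟩
    refine propext (show prediction h z = v b ↔ z ∈ A b from ⟨fun hz => ?_, hval b z⟩)
    rw [hval c z hc] at hz
    rwa [← hv hz]
  have hmap : (testLaw P).map (prediction h) {v b} = testLaw P (A b) := by
    rw [Measure.map_apply hp (measurableSet_singleton _), measure_congr hfiber]
  have hcond : condDistrib label (prediction h) (testLaw P) (v b) =
      ((testLaw P)[|A b]).map label := by
    ext s hs
    rw [condDistrib_apply_of_ne_zero measurable_label _ (by rwa [hmap]), hmap,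
      Measure.map_apply (hp.prodMk measurable_label) ((measurableSet_singleton _).prod hs),
      Measure.map_apply measurable_label hs, cond_apply (hA.measurableSet b)]
    exact congrArg _ (measure_congr (hfiber.inter (ae_eq_refl (label ⁻¹' s))))
  rw [condMean, hcond, integral_map measurable_label.aemeasurable
    measurable_subtype_coe.aestronglyMeasurable]

end Predictor

section Boundary

theorem boundary_zero (n B : ℕ) : boundary n B 0 = 0 := by simp [boundary]

theorem boundary_self (n : ℕ) {B : ℕ} (hB : 1 ≤ B) : boundary n B B = n + 1 := by
  have hB0 : (B : ℝ) ≠ 0 := by positivity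
  rw [boundary, mul_div_cancel₀ _ hB0]
  exact_mod_cast Nat.ceil_natCast (n + 1)

theorem boundary_add_div_le (n B b : ℕ) : boundary n B b + n / B ≤ boundary n B (b + 1) := by
  have hdiv : ((n / B : ℕ) : ℝ) ≤ ((n : ℝ) + 1) / B :=
    Nat.cast_div_le.trans (by gcongr; linarith)
  unfold boundary
  rw [← Nat.ceil_add_natCast (by positivity)]
  refine Nat.ceil_le_ceil ?_
  push_cast
  linarith

theorem monotone_boundary (n B : ℕ) : Monotone (boundary n B) :=
  monotone_nat_of_le_succ fun b => (Nat.le_add_right _ _).trans (boundary_add_div_le n B b)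

theorem boundary_add_one_lt {n B : ℕ} (hB : 1 ≤ B) (hn : 2 * B ≤ n) (b : ℕ) :
    boundary n B b + 1 < boundary n B (b + 1) := by
  have hdiv : 2 ≤ n / B := (Nat.le_div_iff_mul_le hB).2 hn
  have := boundary_add_div_le n B b
  omega

theorem boundary_le {n B b : ℕ} (hB : 1 ≤ B) (hb : b ≤ B) : boundary n B b ≤ n + 1 :=
  (monotone_boundary n B hb).trans_eq (boundary_self n hB)

theorem div_sub_one_le_card_Ioo_boundary (n B b : ℕ) :
    ((n / B : ℕ) : ℝ) - 1 ≤ (Finset.Ioo (boundary n B b) (boundary n B (b + 1))).card := by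
  have := boundary_add_div_le n B b
  rw [Nat.card_Ioo, sub_le_iff_le_add]
  exact_mod_cast (by omega : n / B ≤ boundary n B (b + 1) - boundary n B b - 1 + 1)

end Boundary

section Perturb

variable {δ t u : ℝ}

theorem perturb_mem_Icc (hδ : 0 ≤ δ) (ht : t ∈ Icc (0 : ℝ) 1) (hu : u ∈ Icc (0 : ℝ) 1) :
    perturb δ t u ∈ Icc (0 : ℝ) 1 := by
  have hmul : δ * u ≤ δ * 1 := mul_le_mul_of_nonneg_left hu.2 hδ
  rw [perturb, inv_mul_eq_div]
  exact ⟨div_nonneg (add_nonneg ht.1 (mul_nonneg hδ hu.1)) (by linarith),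
    div_le_one_of_le₀ (by linarith [ht.2]) (by linarith)⟩

theorem abs_sub_perturb_le (hδ : 0 ≤ δ) (ht : t ∈ Icc (0 : ℝ) 1) (hu : u ∈ Icc (0 : ℝ) 1) :
    |t - perturb δ t u| ≤ δ := by
  have hsub : t - perturb δ t u = δ / (1 + δ) * (t - u) := by
    have : 1 + δ ≠ 0 := by positivity
    rw [perturb]
    field_simp
    ring
  have htu : |t - u| ≤ 1 := abs_le.2 ⟨by linarith [ht.1, hu.2], by linarith [ht.2, hu.1]⟩
  rw [hsub, abs_mul, abs_of_nonneg (by positivity)]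
  calc δ / (1 + δ) * |t - u| ≤ δ / (1 + δ) * 1 := by gcongr
    _ ≤ δ := by rw [mul_one]; exact div_le_self hδ (by linarith)

theorem perturb_injective (hδ : 0 < δ) (t : ℝ) : Function.Injective (perturb δ t) :=
  fun u v (huv : (1 + δ)⁻¹ * (t + δ * u) = (1 + δ)⁻¹ * (t + δ * v)) =>
    mul_left_cancel₀ hδ.ne' (add_left_cancel (mul_left_cancel₀ (by positivity) huv))

theorem volume_perturb_preimage_singleton (hδ : 0 < δ) (t c : ℝ) :
    volume ((fun v : I => perturb δ t v) ⁻¹' {c}) = 0 :=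
  Set.Subsingleton.measure_zero (fun _ hv _ hv' =>
    Subtype.ext (perturb_injective hδ t (Eq.trans hv (Eq.symm hv')))) _

end Perturb

section TestScore

variable {𝒳 : Type*} {δ : ℝ} {g : 𝒳 → I}

/-- The perturbed score of a test triple. With `P` tripled by uniform noise as in `testLaw`, the
calibration scores are the values of this function on an i.i.d. sample. -/
def testScore (δ : ℝ) (g : 𝒳 → I) (z : (𝒳 × I) × I) : ℝ := perturb δ (g z.1.1) z.2

theorem testScore_mem_Icc (hδ : 0 ≤ δ) (z : (𝒳 × I) × I) : testScore δ g z ∈ Icc (0 : ℝ) 1 :=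
  perturb_mem_Icc hδ (g z.1.1).2 z.2.2

variable [MeasurableSpace 𝒳]

theorem measurable_testScore (hg : Measurable g) : Measurable (testScore δ g) := by
  unfold testScore perturb
  fun_prop

theorem isContinuousScore_testScore (P : Measure (𝒳 × I)) (hδ : 0 < δ) (hg : Measurable g) :
    IsContinuousScore (testLaw P) (testScore δ g) where
  measurable := measurable_testScore hg
  measure_preimage_singleton c := by
    rw [testLaw, Measure.measure_prod_null (measurable_testScore hg (measurableSet_singleton c))]
    exact ae_of_all _ fun x => volume_perturb_preimage_singleton hδ (g x.1) c
  mem_Icc := testScore_mem_Icc hδ.le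

end TestScore

section Cells

variable {Z : Type*} {S : Z → ℝ}

theorem pairwise_disjoint_scoreCell (hS : ∀ z, S z ∈ Icc (0 : ℝ) 1) {n m : ℕ} {a : ℕ → ℕ}
    (ha : Monotone a) (ω : Fin n → Z) :
    Pairwise (Function.onFun Disjoint fun b : Fin m =>
      scoreCell S (blockEnds (a b) (a (b + 1)) (S ∘ ω))) := by
  intro b c hbc
  have hmono : Monotone (orderStat (S ∘ ω) ∘ a) :=
    (monotone_orderStat fun i => hS (ω i)).comp ha
  exact (hmono.pairwise_disjoint_on_Ico_succ (Fin.val_ne_of_ne hbc)).preimage S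

variable [MeasurableSpace Z] {μ : Measure Z}

theorem IsContinuousScore.isAEPartition_scoreCell (hS : IsContinuousScore μ S) {n m : ℕ}
    {a : ℕ → ℕ} (ha : Monotone a) (ha0 : a 0 = 0) (ham : n < a m) (ω : Fin n → Z) :
    IsAEPartition μ fun b : Fin m => scoreCell S (blockEnds (a b) (a (b + 1)) (S ∘ ω)) where
  measurableSet b := measurableSet_scoreCell hS.measurable _
  pairwise_disjoint := pairwise_disjoint_scoreCell hS.mem_Icc ha ω
  ae_mem := by
    filter_upwards [hS.ae_mem_Ioo] with z hz
    have hmem : S z ∈ Ico ((orderStat (S ∘ ω) ∘ a) 0) ((orderStat (S ∘ ω) ∘ a) m) := by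
      simpa [ha0, orderStat_zero, orderStat_of_lt _ ham] using Ioo_subset_Ico_self hz
    obtain ⟨b, hb, hzb⟩ := mem_iUnion₂.1 (Ico_subset_biUnion_Ico m _ hmem)
    exact ⟨⟨b, Finset.mem_range.1 hb⟩, hzb⟩

end Cells

section Bins

variable {𝒳 : Type*} {n B : ℕ} {δ : ℝ} {g : 𝒳 → I}

/-- The calibration points, each joined with the uniform noise of its score, so that they become
test triples. -/
def joinNoise (τ : (Fin n → 𝒳 × I) × Seed n B) (i : Fin n) : (𝒳 × I) × I := (τ.1 i, τ.2.1 i)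

/-- The test triples whose score falls into the `b`-th bin determined by the sample `ω` (bins are
numbered from `0`). -/
def bin (B : ℕ) (δ : ℝ) (g : 𝒳 → I) (ω : Fin n → (𝒳 × I) × I) (b : ℕ) : Set ((𝒳 × I) × I) :=
  scoreCell (testScore δ g)
    (blockEnds (boundary n B b) (boundary n B (b + 1)) (testScore δ g ∘ ω))

/-- The mean label of the points of the sample `ω` strictly inside the `b`-th bin. -/
def binAvg (B : ℕ) (δ : ℝ) (g : 𝒳 → I) (ω : Fin n → (𝒳 × I) × I) (b : ℕ) : ℝ :=
  blockMean (testScore δ g) (fun z => (label z : ℝ)) (boundary n B b) (boundary n B (b + 1)) ω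

/-- The value `Π̂_b` predicted on the `b`-th bin: the perturbation of `binAvg` by `V_b`. -/
def binValue (B : ℕ) (δ : ℝ) (g : 𝒳 → I) (τ : (Fin n → 𝒳 × I) × Seed n B) (b : Fin B) : ℝ :=
  perturb δ (binAvg B δ g (joinNoise τ) b) (τ.2.2 b)

/-- The almost sure event on which scores and predicted values determine points and bins: scores
are distinct and in `(0, 1)`, and different bins get different values. -/
structure InGeneralPosition (B : ℕ) (δ : ℝ) (g : 𝒳 → I) (τ : (Fin n → 𝒳 × I) × Seed n B) :
    Prop where
  noTies : NoTies (testScore δ g ∘ joinNoise τ)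
  injective_binValue : Function.Injective (binValue B δ g τ)

theorem binAvg_mem_Icc (ω : Fin n → (𝒳 × I) × I) (b : ℕ) : binAvg B δ g ω b ∈ Icc (0 : ℝ) 1 :=
  blockMean_mem_Icc (fun z => (label z).2) _ _ ω

theorem NoTies.binMean_eq (hB : 1 ≤ B) (hn : 2 * B ≤ n) {ω : Fin n → (𝒳 × I) × I}
    (hω : NoTies (testScore δ g ∘ ω)) {b : ℕ} (hb : b < B) :
    binMean B (testScore δ g ∘ ω) (fun i => (label (ω i) : ℝ)) b = binAvg B δ g ω b := by
  have hu : boundary n B (b + 1) ≤ n + 1 := boundary_le hB hb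
  have hl : boundary n B b ≤ n := by
    have := boundary_add_one_lt hB hn b
    omega
  rw [binMean, hω.sum_orderedLabel hl hu, ← hω.card_innerIndices hl hu]
  rfl

variable {τ : (Fin n → 𝒳 × I) × Seed n B}

theorem NoTies.prediction_umd (hB : 1 ≤ B) (hn : 2 * B ≤ n) (hδ : 0 ≤ δ)
    (hτ : NoTies (testScore δ g ∘ joinNoise τ)) {b : Fin B} {z : (𝒳 × I) × I}
    (hz : z ∈ bin B δ g (joinNoise τ) b) :
    prediction (umd B δ g τ.1 τ.2) z = binValue B δ g τ b := by
  classical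
  have hdisj : Pairwise (Function.onFun Disjoint fun c : Fin B => bin B δ g (joinNoise τ) c) :=
    pairwise_disjoint_scoreCell (testScore_mem_Icc hδ) (monotone_boundary n B) _
  rw [← sum_indicator_eq_of_pairwise_disjoint hdisj (binValue B δ g τ) hz, prediction,
    umd]
  refine Finset.sum_congr rfl fun c _ => ?_
  rw [indicator_apply, binValue, ← hτ.binMean_eq hB hn c.2]
  exact if_congr Iff.rfl rfl rfl

variable [MeasurableSpace 𝒳]

/-- The error of the sample mean `binAvg` as an estimate of the mean label of a test triple
conditionally on falling into the `b`-th bin. -/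
def binError (P : Measure (𝒳 × I)) (B : ℕ) (δ : ℝ) (g : 𝒳 → I) (ω : Fin n → (𝒳 × I) × I)
    (b : ℕ) : ℝ :=
  blockError (testLaw P) (testScore δ g) (fun z => (label z : ℝ)) (boundary n B b)
    (boundary n B (b + 1)) ω

theorem isAEPartition_bin (P : Measure (𝒳 × I)) (hB : 1 ≤ B) (hδ : 0 < δ) (hg : Measurable g)
    (ω : Fin n → (𝒳 × I) × I) :
    IsAEPartition (testLaw P) fun b : Fin B => bin B δ g ω b :=
  (isContinuousScore_testScore P hδ hg).isAEPartition_scoreCell (monotone_boundary n B)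
    (boundary_zero n B) (by rw [boundary_self n hB]; exact n.lt_succ_self) ω

theorem measurable_umd (hg : Measurable g) (D : Fin n → 𝒳 × I) (θ : Seed n B) :
    Measurable (umd B δ g D θ) := by
  have hscore : Measurable fun z : 𝒳 × I => perturb δ (g z.1) z.2 := by
    unfold perturb
    fun_prop
  unfold umd
  refine Finset.measurable_sum _ fun b _ => Measurable.ite ?_ measurable_const measurable_const
  exact (measurableSet_le measurable_const hscore).inter (measurableSet_lt hscore measurable_const)

variable {P : Measure (𝒳 × I)} [IsProbabilityMeasure P]

theorem InGeneralPosition.condMean_sub_prediction_umd (hB : 1 ≤ B) (hn : 2 * B ≤ n)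
    (hδ : 0 < δ) (hg : Measurable g) (hτ : InGeneralPosition B δ g τ) {b : Fin B}
    (hb : testLaw P (bin B δ g (joinNoise τ) b) ≠ 0) {z : (𝒳 × I) × I}
    (hz : z ∈ bin B δ g (joinNoise τ) b) :
    condMean P (umd B δ g τ.1 τ.2) (prediction (umd B δ g τ.1 τ.2) z) -
        prediction (umd B δ g τ.1 τ.2) z =
      binAvg B δ g (joinNoise τ) b - binValue B δ g τ b - binError P B δ g (joinNoise τ) b := by
  have hval : ∀ b : Fin B, ∀ z ∈ bin B δ g (joinNoise τ) b,
      prediction (umd B δ g τ.1 τ.2) z = binValue B δ g τ b := fun _ _ =>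
    hτ.noTies.prediction_umd hB hn hδ.le
  rw [hval b z hz, (isAEPartition_bin P hB hδ hg (joinNoise τ)).condMean_eq (measurable_umd hg _ _)
    hτ.injective_binValue hval hb, sub_right_comm]
  exact congrArg (· - _) (sub_sub_cancel _ _).symm

theorem InGeneralPosition.abs_condMean_sub_prediction_umd_le (hB : 1 ≤ B) (hn : 2 * B ≤ n)
    (hδ : 0 < δ) (hg : Measurable g) (hτ : InGeneralPosition B δ g τ) {b : Fin B}
    (hb : testLaw P (bin B δ g (joinNoise τ) b) ≠ 0) {z : (𝒳 × I) × I}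
    (hz : z ∈ bin B δ g (joinNoise τ) b) :
    |condMean P (umd B δ g τ.1 τ.2) (prediction (umd B δ g τ.1 τ.2) z) -
        prediction (umd B δ g τ.1 τ.2) z| ≤ |binError P B δ g (joinNoise τ) b| + δ := by
  rw [hτ.condMean_sub_prediction_umd hB hn hδ hg hb hz, add_comm]
  refine (abs_sub _ _).trans (add_le_add_left ?_ _)
  exact abs_sub_perturb_le hδ.le (binAvg_mem_Icc _ _) (τ.2.2 b).2

end Bins

section GeneralPosition

variable {𝒳 : Type*} [MeasurableSpace 𝒳] {n B : ℕ} {δ : ℝ} {g : 𝒳 → I}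

instance : IsProbabilityMeasure (seedLaw n B) := by
  unfold seedLaw
  infer_instance

instance (P : Measure (𝒳 × I)) [IsProbabilityMeasure P] :
    IsProbabilityMeasure (trainLaw n P (seedLaw n B)) := by
  unfold trainLaw
  infer_instance

theorem measurable_joinNoise : Measurable (joinNoise (𝒳 := 𝒳) (n := n) (B := B)) := by
  unfold joinNoise
  fun_prop

theorem measurable_binAvg (hg : Measurable g) (b : ℕ) :
    Measurable fun ω : Fin n → (𝒳 × I) × I => binAvg B δ g ω b :=
  measurable_blockMean (measurable_testScore hg) (measurable_subtype_coe.comp measurable_label) _ _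

theorem measurable_binValue (hg : Measurable g) (b : Fin B) :
    Measurable fun τ : (Fin n → 𝒳 × I) × Seed n B => binValue B δ g τ b := by
  have havg := (measurable_binAvg (B := B) (δ := δ) hg b).comp
    (measurable_joinNoise (𝒳 := 𝒳) (n := n) (B := B))
  unfold binValue perturb
  exact (havg.add (by fun_prop)).const_mul _

theorem measurableSet_injective_binValue (hg : Measurable g) :
    MeasurableSet {τ : (Fin n → 𝒳 × I) × Seed n B | Function.Injective (binValue B δ g τ)} :=
  measurableSet_setOfPred.2 <| Measurable.forall fun b => Measurable.forall fun c =>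
    Measurable.imp
      (measurableSet_setOfPred.1 <|
        measurableSet_eq_fun (measurable_binValue hg b) (measurable_binValue hg c))
      measurable_const

variable {P : Measure (𝒳 × I)}

theorem ae_injective_binValue (hδ : 0 < δ) (hg : Measurable g) :
    ∀ᵐ τ ∂trainLaw n P (seedLaw n B), Function.Injective (binValue B δ g τ) := by
  have hset := measurableSet_injective_binValue (n := n) (B := B) (δ := δ) hg
  refine (Measure.ae_prod_iff_ae_ae hset).2 (ae_of_all _ fun D => ?_)
  refine (Measure.ae_prod_iff_ae_ae (hset.preimage measurable_prodMk_left)).2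
    (ae_of_all _ fun U => ?_)
  exact ae_pi_injective
    (f := fun (b : Fin B) (v : I) => perturb δ (binAvg B δ g (fun i => (D i, U i)) b) v)
    (fun b => by unfold perturb; fun_prop) fun b => volume_perturb_preimage_singleton hδ _

variable [IsProbabilityMeasure P]

theorem measurePreserving_joinNoise :
    MeasurePreserving (joinNoise (n := n) (B := B)) (trainLaw n P (seedLaw n B))
      (Measure.pi fun _ => testLaw P) := by
  have hfst : MeasurePreserving (Prod.map id Prod.fst) (trainLaw n P (seedLaw n B))
      ((Measure.pi fun _ : Fin n => P).prod (Measure.pi fun _ : Fin n => (volume : Measure I))) :=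
    (MeasurePreserving.id _).prod measurePreserving_fst
  exact (measurePreserving_arrowProdEquivProdArrow (𝒳 × I) I (Fin n) (fun _ => P)
    fun _ => volume).symm.comp hfst

theorem ae_inGeneralPosition (hδ : 0 < δ) (hg : Measurable g) :
    ∀ᵐ τ ∂trainLaw n P (seedLaw n B), InGeneralPosition B δ g τ := by
  filter_upwards [measurePreserving_joinNoise.quasiMeasurePreserving.ae
    ((isContinuousScore_testScore P hδ hg).ae_noTies n), ae_injective_binValue hδ hg] with τ hτ hv
  exact ⟨hτ, hv⟩

end GeneralPosition

section BinError

variable {𝒳 : Type*} [MeasurableSpace 𝒳] {P : Measure (𝒳 × I)} {n B : ℕ} {δ : ℝ} {g : 𝒳 → I}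

theorem measurable_measure_bin [IsProbabilityMeasure P] (hg : Measurable g) (b : ℕ) :
    Measurable fun ω : Fin n → (𝒳 × I) × I => testLaw P (bin B δ g ω b) :=
  (measurable_measure_scoreCell (measurable_testScore hg)).comp
    ((measurable_blockEnds _ _).comp (measurable_comp_sample (measurable_testScore hg)))

theorem measurable_binError [IsProbabilityMeasure P] (hg : Measurable g) (b : ℕ) :
    Measurable fun ω : Fin n → (𝒳 × I) × I => binError P B δ g ω b :=
  measurable_blockError (measurable_testScore hg)
    (measurable_subtype_coe.comp measurable_label) _ _

end BinError

section Calibrated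

variable {𝒳 : Type*} [MeasurableSpace 𝒳] {P : Measure (𝒳 × I)} [IsProbabilityMeasure P] {n B : ℕ}
  {δ : ℝ} {g : 𝒳 → I}

theorem setLIntegral_abs_binError_ge_le (hB : 1 ≤ B) (hn : 2 * B ≤ n) (hδ : 0 < δ)
    (hg : Measurable g) {b : ℕ} (hb : b < B) {w : ℝ × ℝ → ENNReal} (hw : Measurable w) {ε : ℝ}
    (hε : 0 ≤ ε) :
    ∫⁻ ω in {ω : Fin n → (𝒳 × I) × I | ε ≤ |binError P B δ g ω b|},
        w (blockEnds (boundary n B b) (boundary n B (b + 1)) (testScore δ g ∘ ω))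
        ∂(Measure.pi fun _ => testLaw P) ≤
      (∫⁻ ω : Fin n → (𝒳 × I) × I,
          w (blockEnds (boundary n B b) (boundary n B (b + 1)) (testScore δ g ∘ ω))
          ∂(Measure.pi fun _ => testLaw P)) *
        ENNReal.ofReal (2 * Real.exp (-(2 * (((n / B : ℕ) : ℝ) - 1) * ε ^ 2))) := by
  refine (setLIntegral_abs_blockError_ge_le (isContinuousScore_testScore P hδ hg)
    (measurable_subtype_coe.comp measurable_label) (fun z => (label z).2)
    (boundary_add_one_lt hB hn b) (boundary_le hB hb) hw hε).trans ?_
  gcongr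
  exact div_sub_one_le_card_Ioo_boundary n B b

theorem measure_mem_bin_and_abs_binError_ge_le (hB : 1 ≤ B) (hn : 2 * B ≤ n) (hδ : 0 < δ)
    (hg : Measurable g) {b : ℕ} (hb : b < B) {ε : ℝ} (hε : 0 ≤ ε) :
    ((Measure.pi fun _ : Fin n => testLaw P).prod (testLaw P))
        {x | x.2 ∈ bin B δ g x.1 b ∧ ε ≤ |binError P B δ g x.1 b|} ≤
      (∫⁻ ω : Fin n → (𝒳 × I) × I, testLaw P (bin B δ g ω b)
          ∂(Measure.pi fun _ => testLaw P)) *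
        ENNReal.ofReal (2 * Real.exp (-(2 * (((n / B : ℕ) : ℝ) - 1) * ε ^ 2))) := by
  have hdev : MeasurableSet {ω : Fin n → (𝒳 × I) × I | ε ≤ |binError P B δ g ω b|} :=
    measurableSet_le measurable_const (measurable_binError hg b).abs
  have hbin : MeasurableSet {x : (Fin n → (𝒳 × I) × I) × ((𝒳 × I) × I) | x.2 ∈ bin B δ g x.1 b} :=
    measurableSet_mem_scoreCell_blockEnds (measurable_testScore hg) _ _
  have hboth : MeasurableSet {x : (Fin n → (𝒳 × I) × I) × ((𝒳 × I) × I) |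
      x.2 ∈ bin B δ g x.1 b ∧ ε ≤ |binError P B δ g x.1 b|} :=
    hbin.inter (hdev.preimage measurable_fst)
  calc _ = ∫⁻ ω in {ω : Fin n → (𝒳 × I) × I | ε ≤ |binError P B δ g ω b|},
        testLaw P (bin B δ g ω b) ∂(Measure.pi fun _ => testLaw P) := by
        rw [Measure.prod_apply hboth, ← lintegral_indicator hdev]
        refine lintegral_congr fun ω => ?_
        by_cases hω : ε ≤ |binError P B δ g ω b| <;> simp [indicator, hω]
    _ ≤ _ := setLIntegral_abs_binError_ge_le hB hn hδ hg hb
        (measurable_measure_scoreCell (measurable_testScore hg)) hε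

theorem measure_exists_mem_bin_and_abs_binError_ge_le (hB : 1 ≤ B) (hn : 2 * B ≤ n) (hδ : 0 < δ)
    (hg : Measurable g) {ε : ℝ} (hε : 0 ≤ ε) :
    ((Measure.pi fun _ : Fin n => testLaw P).prod (testLaw P))
        {x | ∃ b : Fin B, x.2 ∈ bin B δ g x.1 b ∧ ε ≤ |binError P B δ g x.1 b|} ≤
      ENNReal.ofReal (2 * Real.exp (-(2 * (((n / B : ℕ) : ℝ) - 1) * ε ^ 2))) := by
  set C := ENNReal.ofReal (2 * Real.exp (-(2 * (((n / B : ℕ) : ℝ) - 1) * ε ^ 2)))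
  have htotal : ∑ b : Fin B, ∫⁻ ω : Fin n → (𝒳 × I) × I, testLaw P (bin B δ g ω b)
      ∂(Measure.pi fun _ => testLaw P) = 1 := by
    rw [← lintegral_finsetSum (f := fun (b : Fin B) ω => testLaw P (bin B δ g ω b)) _ fun b _ =>
      measurable_measure_bin hg b]
    simp [(isAEPartition_bin P hB hδ hg _).sum_measure]
  rw [ofPred_exists]
  refine (measure_iUnion_fintype_le _ _).trans ?_
  calc _ ≤ ∑ b : Fin B, (∫⁻ ω : Fin n → (𝒳 × I) × I, testLaw P (bin B δ g ω b)
          ∂(Measure.pi fun _ => testLaw P)) * C :=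
        Finset.sum_le_sum fun b _ => measure_mem_bin_and_abs_binError_ge_le hB hn hδ hg b.2 hε
    _ = C := by rw [← Finset.sum_mul, htotal, one_mul]

theorem ae_mem_bin_and_measure_ne_zero (hB : 1 ≤ B) (hδ : 0 < δ) (hg : Measurable g)
    (ν : Measure (Fin n → (𝒳 × I) × I)) :
    ∀ᵐ x ∂ν.prod (testLaw P), ∃ b : Fin B,
      x.2 ∈ bin B δ g x.1 b ∧ testLaw P (bin B δ g x.1 b) ≠ 0 := by
  refine (Measure.ae_prod_iff_ae_ae ?_).2
    (ae_of_all _ fun ω => (isAEPartition_bin P hB hδ hg ω).ae_mem_and_measure_ne_zero)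
  rw [ofPred_exists]
  refine MeasurableSet.iUnion fun b => MeasurableSet.inter
    (measurableSet_mem_scoreCell_blockEnds (measurable_testScore hg) _ _) ?_
  exact ((measurable_measure_bin hg b).comp measurable_fst (measurableSet_singleton 0)).compl

variable (𝒳)

theorem marginallyCalibrated_umd (hB : 1 ≤ B) (hn : 2 * B ≤ n) (hδ : 0 < δ) {ε : ℝ}
    (hε : 0 ≤ ε) :
    MarginallyCalibrated (𝒳 := 𝒳) (n := n) (seedLaw n B) (umd B δ) (ε + δ)
      (2 * Real.exp (-(2 * (((n / B : ℕ) : ℝ) - 1) * ε ^ 2))) := by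
  intro g hg P _
  have hjoin : MeasurePreserving (Prod.map joinNoise id)
      ((trainLaw n P (seedLaw n B)).prod (testLaw P))
      ((Measure.pi fun _ : Fin n => testLaw P).prod (testLaw P)) :=
    measurePreserving_joinNoise.prod (MeasurePreserving.id _)
  refine le_trans (measure_mono_ae ?_) ((hjoin.measure_preimage_le _).trans
    (measure_exists_mem_bin_and_abs_binError_ge_le hB hn hδ hg hε))
  filter_upwards [hjoin.quasiMeasurePreserving.ae (ae_mem_bin_and_measure_ne_zero hB hδ hg _),
    Measure.quasiMeasurePreserving_fst.ae (ae_inGeneralPosition hδ hg)] with x ⟨b, hz, hb⟩ hτ hx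
  refine ⟨b, hz, le_of_not_gt fun (hlt : |binError P B δ g (joinNoise x.1) b| < ε) => hx ?_⟩
  exact (hτ.abs_condMean_sub_prediction_umd_le hB hn hδ hg hb hz).trans (by gcongr)

theorem conditionallyCalibrated_umd (hB : 1 ≤ B) (hn : 2 * B ≤ n) (hδ : 0 < δ) {ε : ℝ}
    (hε : 0 ≤ ε) :
    ConditionallyCalibrated (𝒳 := 𝒳) (n := n) (seedLaw n B) (umd B δ) (ε + δ)
      (B * (2 * Real.exp (-(2 * (((n / B : ℕ) : ℝ) - 1) * ε ^ 2)))) := by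
  intro g hg P _
  set dev : Fin B → Set (Fin n → (𝒳 × I) × I) := fun b => {ω | ε ≤ |binError P B δ g ω b|}
  calc _ ≤ trainLaw n P (seedLaw n B) (joinNoise ⁻¹' ⋃ b, dev b) := by
        refine measure_mono_ae ?_
        filter_upwards [ae_inGeneralPosition hδ hg] with τ hτ hx
        by_contra hdev
        refine hx ((uniformlyCalibrated_iff_ae_prediction (measurable_umd hg _ _)).2 ?_)
        filter_upwards [(isAEPartition_bin P hB hδ hg (joinNoise τ)).ae_mem_and_measure_ne_zero]
          with z ⟨b, hz, hb⟩
        have hlt : |binError P B δ g (joinNoise τ) b| < ε :=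
          lt_of_not_ge fun hge => hdev (mem_iUnion.2 ⟨b, hge⟩)
        exact (hτ.abs_condMean_sub_prediction_umd_le hB hn hδ hg hb hz).trans (by gcongr)
    _ ≤ (Measure.pi fun _ => testLaw P) (⋃ b, dev b) :=
        measurePreserving_joinNoise.measure_preimage_le _
    _ ≤ ∑ b, (Measure.pi fun _ => testLaw P) (dev b) := measure_iUnion_fintype_le _ _
    _ ≤ ∑ _b : Fin B,
          ENNReal.ofReal (2 * Real.exp (-(2 * (((n / B : ℕ) : ℝ) - 1) * ε ^ 2))) :=
        Finset.sum_le_sum fun b _ => by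
          simpa [dev] using setLIntegral_abs_binError_ge_le (P := P) hB hn hδ hg b.2
            (w := fun _ => 1) measurable_const hε
    _ = _ := by simp [ENNReal.ofReal_mul]

end Calibrated

theorem exp_neg_two_mul_sq_sqrt_log_div {m x : ℝ} (hm : 0 < m) (hx : 1 ≤ x) :
    Real.exp (-(2 * m * √(Real.log x / (2 * m)) ^ 2)) = x⁻¹ := by
  rw [Real.sq_sqrt (div_nonneg (Real.log_nonneg hx) (by positivity)),
    mul_div_cancel₀ _ (by positivity), Real.exp_neg, Real.exp_log (by linarith)]

section ExpectedError

variable {𝒳 : Type*} [MeasurableSpace 𝒳] {n B : ℕ} {δ : ℝ} {g : 𝒳 → I}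

/-- The mean square of `binError` over the bin of a test triple. -/
def sqError (P : Measure (𝒳 × I)) (B : ℕ) (δ : ℝ) (g : 𝒳 → I) (ω : Fin n → (𝒳 × I) × I) : ℝ :=
  ∑ b : Fin B, (testLaw P).real (bin B δ g ω b) * binError P B δ g ω b ^ 2

theorem sqError_nonneg (P : Measure (𝒳 × I)) (B : ℕ) (δ : ℝ) (g : 𝒳 → I)
    (ω : Fin n → (𝒳 × I) × I) : 0 ≤ sqError P B δ g ω :=
  Finset.sum_nonneg fun _ _ => mul_nonneg measureReal_nonneg (sq_nonneg _)

theorem add_one_div_mul_one_div_le {n N : ℕ} (hn : 0 < n) (hN : 0 < N) :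
    ((N + 1 : ℕ) : ENNReal) / (n + 1) * ENNReal.ofReal (1 / (4 * N)) ≤
      ENNReal.ofReal (1 / (2 * n)) := by
  have : (0 : ℝ) < n := by exact_mod_cast hn
  have : (1 : ℝ) ≤ N := by exact_mod_cast hN
  have hfrac : ((N + 1 : ℕ) : ENNReal) / (n + 1) = ENNReal.ofReal ((N + 1) / (n + 1)) := by
    rw [ENNReal.ofReal_div_of_pos (by positivity)]
    norm_cast
  rw [hfrac, ← ENNReal.ofReal_mul (by positivity)]
  refine ENNReal.ofReal_le_ofReal ?_
  rw [div_mul_div_comm, mul_one, div_le_div_iff₀ (by positivity) (by positivity)]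
  nlinarith

variable {P : Measure (𝒳 × I)} [IsProbabilityMeasure P]

theorem measurable_sqError (hg : Measurable g) : Measurable (sqError (n := n) P B δ g) :=
  Finset.measurable_sum _ fun b _ =>
    (measurable_measure_bin hg b).ennreal_toReal.mul ((measurable_binError hg b).pow_const 2)

theorem lintegral_measure_bin_mul_sq_binError_le (hB : 1 ≤ B) (hn : 2 * B ≤ n) (hδ : 0 < δ)
    (hg : Measurable g) {b : ℕ} (hb : b < B) :
    ∫⁻ ω : Fin n → (𝒳 × I) × I, testLaw P (bin B δ g ω b) *
        ENNReal.ofReal (binError P B δ g ω b ^ 2) ∂(Measure.pi fun _ => testLaw P) ≤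
      ENNReal.ofReal (1 / (2 * n)) := by
  have hS := isContinuousScore_testScore P hδ hg
  have hlt := boundary_add_one_lt hB hn b
  have hcard : boundary n B (b + 1) - boundary n B b =
      (Finset.Ioo (boundary n B b) (boundary n B (b + 1))).card + 1 := by
    rw [Nat.card_Ioo]
    omega
  refine (lintegral_sq_blockError_le hS (measurable_subtype_coe.comp measurable_label)
    (fun z => (label z).2) hlt (boundary_le hB hb)
    (measurable_measure_scoreCell hS.measurable)).trans ?_
  refine (mul_le_mul_left (hS.lintegral_measure_scoreCell_le _ _) _).trans ?_
  rw [hcard]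
  exact add_one_div_mul_one_div_le (by omega) (by rw [Nat.card_Ioo]; omega)

theorem lintegral_sqError_le (hB : 1 ≤ B) (hn : 2 * B ≤ n) (hδ : 0 < δ) (hg : Measurable g) :
    ∫⁻ ω, ENNReal.ofReal (sqError P B δ g ω) ∂(Measure.pi fun _ : Fin n => testLaw P) ≤
      ENNReal.ofReal (B / (2 * n)) := by
  have hsum : ∀ ω : Fin n → (𝒳 × I) × I, ENNReal.ofReal (sqError P B δ g ω) =
      ∑ b : Fin B, testLaw P (bin B δ g ω b) * ENNReal.ofReal (binError P B δ g ω b ^ 2) := by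
    intro ω
    rw [sqError, ENNReal.ofReal_sum_of_nonneg fun _ _ =>
      mul_nonneg measureReal_nonneg (sq_nonneg _)]
    exact Finset.sum_congr rfl fun b _ => by
      rw [ENNReal.ofReal_mul measureReal_nonneg, ofReal_measureReal]
  have hmeas : ∀ b : Fin B, Measurable fun ω : Fin n → (𝒳 × I) × I =>
      testLaw P (bin B δ g ω b) * ENNReal.ofReal (binError P B δ g ω b ^ 2) := fun b =>
    (measurable_measure_bin hg b).mul ((measurable_binError hg b).pow_const 2).ennreal_ofReal
  simp only [hsum]
  rw [lintegral_finsetSum _ fun b _ => hmeas b]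
  calc _ ≤ ∑ _b : Fin B, ENNReal.ofReal (1 / (2 * n)) := Finset.sum_le_sum fun b _ =>
        lintegral_measure_bin_mul_sq_binError_le hB hn hδ hg b.2
    _ = ENNReal.ofReal (B / (2 * n)) := by
      rw [Finset.sum_const, Finset.card_univ, Fintype.card_fin, nsmul_eq_mul,
        ← ENNReal.ofReal_natCast, ← ENNReal.ofReal_mul (by positivity), mul_one_div]

theorem lintegral_sqError_joinNoise_le (hB : 1 ≤ B) (hn : 2 * B ≤ n) (hδ : 0 < δ)
    (hg : Measurable g) :
    ∫⁻ τ, ENNReal.ofReal (sqError P B δ g (joinNoise τ)) ∂trainLaw n P (seedLaw n B) ≤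
      ENNReal.ofReal (B / (2 * n)) := by
  rw [measurePreserving_joinNoise.lintegral_comp (measurable_sqError hg).ennreal_ofReal]
  exact lintegral_sqError_le hB hn hδ hg

theorem integrable_sqError_joinNoise (hB : 1 ≤ B) (hn : 2 * B ≤ n) (hδ : 0 < δ)
    (hg : Measurable g) :
    Integrable (fun τ => sqError P B δ g (joinNoise τ)) (trainLaw n P (seedLaw n B)) := by
  refine ⟨((measurable_sqError hg).comp measurable_joinNoise).aestronglyMeasurable, ?_⟩
  rw [hasFiniteIntegral_iff_ofReal (ae_of_all _ fun τ => sqError_nonneg P B δ g _)]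
  exact (lintegral_sqError_joinNoise_le hB hn hδ hg).trans_lt ENNReal.ofReal_lt_top

theorem integral_sqError_joinNoise_le (hB : 1 ≤ B) (hn : 2 * B ≤ n) (hδ : 0 < δ)
    (hg : Measurable g) :
    ∫ τ, sqError P B δ g (joinNoise τ) ∂trainLaw n P (seedLaw n B) ≤ B / (2 * n) := by
  rw [integral_eq_lintegral_of_nonneg_ae (ae_of_all _ fun τ => sqError_nonneg P B δ g _)
    (integrable_sqError_joinNoise hB hn hδ hg).aestronglyMeasurable]
  exact ENNReal.toReal_le_of_le_ofReal (by positivity)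
    (lintegral_sqError_joinNoise_le hB hn hδ hg)

end ExpectedError

section ECE

variable {𝒳 : Type*} [MeasurableSpace 𝒳] {n B : ℕ} {δ : ℝ} {g : 𝒳 → I} {P : Measure (𝒳 × I)}
  [IsProbabilityMeasure P]

theorem ece_nonneg (P : Measure (𝒳 × I)) [IsProbabilityMeasure P] (h : 𝒳 × I → ℝ) (p : ℝ) :
    0 ≤ ece P h p :=
  Real.rpow_nonneg (integral_nonneg fun _ => Real.rpow_nonneg (abs_nonneg _) _) _

theorem InGeneralPosition.ece_umd_eq (hB : 1 ≤ B) (hn : 2 * B ≤ n) (hδ : 0 < δ)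
    (hg : Measurable g) {τ : (Fin n → 𝒳 × I) × Seed n B} (hτ : InGeneralPosition B δ g τ) (p : ℝ) :
    ece P (umd B δ g τ.1 τ.2) p =
      (∑ b : Fin B, (testLaw P).real (bin B δ g (joinNoise τ) b) *
        |binAvg B δ g (joinNoise τ) b - binValue B δ g τ b -
          binError P B δ g (joinNoise τ) b| ^ p) ^ (1 / p) := by
  rw [ece, (isAEPartition_bin P hB hδ hg (joinNoise τ)).integral_eq_sum fun b hb z hz => by
    rw [hτ.condMean_sub_prediction_umd hB hn hδ hg hb hz]]

theorem InGeneralPosition.ece_umd_le (hB : 1 ≤ B) (hn : 2 * B ≤ n) (hδ : 0 < δ)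
    (hg : Measurable g) {τ : (Fin n → 𝒳 × I) × Seed n B} (hτ : InGeneralPosition B δ g τ) {p : ℝ}
    (hp : 1 ≤ p) (hp2 : p ≤ 2) :
    ece P (umd B δ g τ.1 τ.2) p ≤ √(sqError P B δ g (joinNoise τ)) + δ := by
  have hpred := measurable_prediction (measurable_umd (B := B) (δ := δ) hg τ.1 τ.2)
  exact (isAEPartition_bin P hB hδ hg (joinNoise τ)).integral_rpow_abs_le_sqrt_sum_add
    ((measurable_condMean.comp hpred).sub hpred).aestronglyMeasurable hδ.le
    (fun b hb z hz => hτ.abs_condMean_sub_prediction_umd_le hB hn hδ hg hb hz) hp hp2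

theorem aestronglyMeasurable_ece_umd (hB : 1 ≤ B) (hn : 2 * B ≤ n) (hδ : 0 < δ)
    (hg : Measurable g) (p : ℝ) :
    AEStronglyMeasurable (fun τ => ece P (umd B δ g τ.1 τ.2) p) (trainLaw n P (seedLaw n B)) := by
  have hjoin := measurable_joinNoise (𝒳 := 𝒳) (n := n) (B := B)
  have hsum : Measurable fun τ : (Fin n → 𝒳 × I) × Seed n B =>
      (∑ b : Fin B, (testLaw P).real (bin B δ g (joinNoise τ) b) *
        |binAvg B δ g (joinNoise τ) b - binValue B δ g τ b -
          binError P B δ g (joinNoise τ) b| ^ p) ^ (1 / p) := by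
    refine (Finset.measurable_sum _ fun b _ => ?_).pow_const _
    have hdiff : Measurable fun τ : (Fin n → 𝒳 × I) × Seed n B =>
        binAvg B δ g (joinNoise τ) b - binValue B δ g τ b - binError P B δ g (joinNoise τ) b :=
      (((measurable_binAvg hg b).comp hjoin).sub (measurable_binValue hg b)).sub
        ((measurable_binError (P := P) hg b).comp hjoin)
    exact ((measurable_measure_bin hg b).comp hjoin).ennreal_toReal.mul (hdiff.abs.pow_const p)
  refine ⟨_, hsum.stronglyMeasurable, ?_⟩
  filter_upwards [ae_inGeneralPosition hδ hg] with τ hτ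
  exact hτ.ece_umd_eq hB hn hδ hg p

theorem ae_abs_ece_umd_le (hB : 1 ≤ B) (hn : 2 * B ≤ n) (hδ : 0 < δ) (hg : Measurable g) {p : ℝ}
    (hp : 1 ≤ p) (hp2 : p ≤ 2) :
    ∀ᵐ τ ∂trainLaw n P (seedLaw n B),
      |ece P (umd B δ g τ.1 τ.2) p| ≤ |√(sqError P B δ g (joinNoise τ))| + δ := by
  filter_upwards [ae_inGeneralPosition hδ hg] with τ hτ
  rw [abs_of_nonneg (ece_nonneg P _ p), abs_of_nonneg (Real.sqrt_nonneg _)]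
  exact hτ.ece_umd_le hB hn hδ hg hp hp2

theorem memLp_sqrt_sqError_joinNoise (hB : 1 ≤ B) (hn : 2 * B ≤ n) (hδ : 0 < δ)
    (hg : Measurable g) :
    MemLp (fun τ => √(sqError P B δ g (joinNoise τ))) 2 (trainLaw n P (seedLaw n B)) := by
  have hmeas : Measurable fun τ : (Fin n → 𝒳 × I) × Seed n B =>
      √(sqError P B δ g (joinNoise τ)) :=
    ((measurable_sqError hg).comp measurable_joinNoise).sqrt
  refine (memLp_two_iff_integrable_sq hmeas.aestronglyMeasurable).2 ?_
  simpa only [Function.comp_apply, Real.sq_sqrt (sqError_nonneg P B δ g _)] using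
    integrable_sqError_joinNoise hB hn hδ hg

theorem integrable_ece_umd (hB : 1 ≤ B) (hn : 2 * B ≤ n) (hδ : 0 < δ) (hg : Measurable g) {p : ℝ}
    (hp : 1 ≤ p) (hp2 : p ≤ 2) :
    Integrable (fun τ => ece P (umd B δ g τ.1 τ.2) p) (trainLaw n P (seedLaw n B)) :=
  (((memLp_sqrt_sqError_joinNoise hB hn hδ hg).integrable one_le_two).abs.add
    (integrable_const δ)).mono' (aestronglyMeasurable_ece_umd hB hn hδ hg p)
    (ae_abs_ece_umd_le hB hn hδ hg hp hp2)

theorem integral_ece_umd_le (hB : 1 ≤ B) (hn : 2 * B ≤ n) (hδ : 0 < δ) (hg : Measurable g) {p : ℝ}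
    (hp : 1 ≤ p) (hp2 : p ≤ 2) :
    ∫ τ, ece P (umd B δ g τ.1 τ.2) p ∂trainLaw n P (seedLaw n B) ≤ √(B / (2 * n)) + δ := by
  have hL1 := integral_rpow_abs_le_sqrt_integral_sq_add (aestronglyMeasurable_ece_umd hB hn hδ hg p)
    (memLp_sqrt_sqError_joinNoise (P := P) hB hn hδ hg) hδ.le
    (ae_abs_ece_umd_le hB hn hδ hg hp hp2) le_rfl one_le_two
  simp only [Real.rpow_one, div_one, abs_of_nonneg (ece_nonneg P _ p),
    Real.sq_sqrt (sqError_nonneg P B δ g _)] at hL1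
  exact hL1.trans (by gcongr; exact integral_sqError_joinNoise_le hB hn hδ hg)

end ECE

end RandomizedUMD

end

theorem theorem2 {𝒳 : Type*} [MeasurableSpace 𝒳] (n B : ℕ) (hB : 1 ≤ B) (hn : 2 * B ≤ n)
    (δ : ℝ) (hδ : 0 < δ) :
    (∀ α : ℝ, 0 < α → α < 1 → ∀ ε₁ ε₂ : ℝ,
      ε₁ = √(Real.log (2 / α) / (2 * ((⌊(n : ℝ) / (B : ℝ)⌋₊ : ℝ) - 1))) + δ →
      ε₂ = √(Real.log (2 * (B : ℝ) / α) / (2 * ((⌊(n : ℝ) / (B : ℝ)⌋₊ : ℝ) - 1))) + δ →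
      RandomizedUMD.MarginallyCalibrated (𝒳 := 𝒳) (n := n)
          (RandomizedUMD.seedLaw n B) (RandomizedUMD.umd B δ) ε₁ α ∧
      RandomizedUMD.ConditionallyCalibrated (𝒳 := 𝒳) (n := n)
          (RandomizedUMD.seedLaw n B) (RandomizedUMD.umd B δ) ε₂ α ∧
      ∀ g : 𝒳 → I, Measurable g → ∀ (P : Measure (𝒳 × I)) [IsProbabilityMeasure P],
        RandomizedUMD.trainLaw n P (RandomizedUMD.seedLaw n B)
          {τ | ∀ p : ℝ, 1 ≤ p →
            RandomizedUMD.ece P (RandomizedUMD.umd B δ g τ.1 τ.2) p ≤ ε₂}ᶜ ≤ ENNReal.ofReal α) ∧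
    ∀ g : 𝒳 → I, Measurable g → ∀ (P : Measure (𝒳 × I)) [IsProbabilityMeasure P],
      ∀ p : ℝ, 1 ≤ p → p ≤ 2 →
        Integrable (fun τ => RandomizedUMD.ece P (RandomizedUMD.umd B δ g τ.1 τ.2) p)
          (RandomizedUMD.trainLaw n P (RandomizedUMD.seedLaw n B)) ∧
        ∫ τ, RandomizedUMD.ece P (RandomizedUMD.umd B δ g τ.1 τ.2) p
          ∂(RandomizedUMD.trainLaw n P (RandomizedUMD.seedLaw n B))
          ≤ √((B : ℝ) / (2 * (n : ℝ))) + δ := by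
  refine ⟨fun α hα hα1 ε₁ ε₂ h₁ h₂ => ?_, fun g hg P _ p hp hp2 =>
    ⟨RandomizedUMD.integrable_ece_umd hB hn hδ hg hp hp2,
      RandomizedUMD.integral_ece_umd_le hB hn hδ hg hp hp2⟩⟩
  subst h₁ h₂
  rw [Nat.floor_div_eq_div]
  have hB' : (1 : ℝ) ≤ B := by exact_mod_cast hB
  have hm : (0 : ℝ) < ((n / B : ℕ) : ℝ) - 1 := by
    have : 1 < n / B := (Nat.le_div_iff_mul_le hB).2 hn
    exact sub_pos.2 (by exact_mod_cast this)
  have hmarg := RandomizedUMD.marginallyCalibrated_umd 𝒳 hB hn hδ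
    (Real.sqrt_nonneg (Real.log (2 / α) / (2 * (((n / B : ℕ) : ℝ) - 1))))
  have hcond := RandomizedUMD.conditionallyCalibrated_umd 𝒳 hB hn hδ
    (Real.sqrt_nonneg (Real.log (2 * B / α) / (2 * (((n / B : ℕ) : ℝ) - 1))))
  rw [RandomizedUMD.exp_neg_two_mul_sq_sqrt_log_div hm ((one_le_div hα).2 (by linarith)),
    inv_div, mul_div_cancel₀ _ two_ne_zero] at hmarg
  rw [RandomizedUMD.exp_neg_two_mul_sq_sqrt_log_div hm ((one_le_div hα).2 (by linarith)),
    inv_div, ← mul_assoc, mul_comm (B : ℝ), mul_div_cancel₀ _ (by positivity)] at hcond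
  refine ⟨hmarg, hcond, fun g hg P _ => (measure_mono (compl_subset_compl.2 ?_)).trans
    (hcond g hg P)⟩
  intro τ hτ p hp
  exact RandomizedUMD.UniformlyCalibrated.ece_le (RandomizedUMD.measurable_umd hg τ.1 τ.2)
    (by positivity) hτ (zero_lt_one.trans_le hp)
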